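/- A *measured standard Borel space* is a pair $(X,\mu)$ of a standard Borel space $X$ and a probability measure $\mu$ on $X$. Let $\mathbf{Krn}$ be the category whose objects are the measured standard Borel spaces and whose morphisms $(X,\mu)\to(Y,\nu)$ are the Markov kernels $f$ from $X$ to $Y$ with $\nu(B)=\int_X f(x)(B)\,d\mu(x)$ for all measurable $B\subseteq Y$, two kernels $f,g$ being identified when $\mu\{x: f(x)\neq g(x)\}=0$; composition is composition of kernels. The Bayesian inverse of $f$ is the morphism $f^{\dagger}:(Y,\nu)\to(X,\mu)$ determined by $\int_A f(x)(B)\,d\mu(x)=\int_B f^{\dagger}(y)(A)\,d\nu(y)$ for all measurable $A\subseteq X$, $B\subseteq Y$; it defines a contravariant functor $(-)^{\dagger}:\mathbf{Krn}^{\mathrm{op}}\to\mathbf{Krn}$ that is the identity on objects. Let $\mathbf{BL}_\sigma$ be the category of Banach lattices and $\sigma$-order continuous positive linear operators $T$ (if $v_n\uparrow v$ then $Tv=\bigvee_n Tv_n$). For a Banach lattice $V$ let $V^\sigma$ be its $\sigma$-order dual (Köthe dual): the Banach lattice of bounded linear functionals $F:V\to\mathbb R$ with $F(v_n)\to0$ whenever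 $v_n\downarrow0$, ordered by $F\le G$ iff $F(v)\le G(v)$ for all $v\ge0$, with the operator norm. Pre-composition makes $(-)^\sigma$ a functor $\mathbf{BL}_\sigma^{\mathrm{op}}\to\mathbf{BL}_\sigma$. For $1\le p\le\infty$ let $\mathsf L^p:\mathbf{Krn}^{\mathrm{op}}\to\mathbf{BL}_\sigma$ be the contravariant functor $(X,\mu)\mapsto L^p(X,\mu)$ (real-valued functions, order $\mu$-a.e.), which sends $f:(X,\mu)\to(Y,\nu)$ to $\phi\mapsto\big(x\mapsto\int_Y\phi\,df(x)\big)$, and let $\mathsf L_p:\mathbf{Krn}\to\mathbf{BL}_\sigma$, $\mathsf L_p=\mathsf L^p\circ(-)^{\dagger}$, be the corresponding covariant functor. Let $\mathsf M:\mathbf{Krn}\to\mathbf{BL}_\sigma$ send $(X,\mu)$ to the Banach lattice of finite signed measures on $X$ that are absolutely continuous with respect to $\mu$ (setwise order, total variation norm) and $f$ to $\rho\mapsto\int_X f(x)(-)\,d\rho(x)$. Let $\mathsf{rr}:(-)^\sigma\circ\mathsf L^\infty\to\mathsf M$ be given by $\mathsf{rr}_{(X,\mu)}(F)(B)=F(1_B)$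 and $\mathsf{rn}:\mathsf M\to\mathsf L_1$ by $\mathsf{rn}_{(X,\mu)}(\rho)=\frac{d\rho}{d\mu}$. **Theorem.** The families $\mathsf{rr}$ and $\mathsf{rn}$ are natural transformations of functors $\mathbf{Krn}\to\mathbf{BL}_\sigma$. Let $1\le p,q\le\infty$ with $\frac1p+\frac1q=1$ (where $\frac1\infty=0$). Then for every $(X,\mu)$ the restriction $L^q(X,\mu)^\sigma\to L^\infty(X,\mu)^\sigma$, $F\mapsto F|_{L^\infty(X,\mu)}$, and the inclusion $L^p(X,\mu)\to L^1(X,\mu)$ are injective, and $\mathsf{rn}\circ\mathsf{rr}$ restricts along them to a natural transformation $(-)^\sigma\circ\mathsf L^q\to\mathsf L_p$: there is a unique natural transformation $\eta:(-)^\sigma\circ\mathsf L^q\to\mathsf L_p$ of functors $\mathbf{Krn}\to\mathbf{BL}_\sigma$ such that, for every $(X,\mu)$ and every $F\in L^q(X,\mu)^\sigma$, the image of $\eta_{(X,\mu)}(F)\in L^p(X,\mu)$ in $L^1(X,\mu)$ is $\mathsf{rn}_{(X,\mu)}\big(\mathsf{rr}_{(X,\mu)}(F|_{L^\infty(X,\mu)})\big)$.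 -/

import Mathlib

open MeasureTheory ProbabilityTheory CategoryTheory Filter Topology
open scoped ENNReal

universe u

set_option linter.unusedSectionVars false
set_option linter.unusedVariables false

namespace KrnBL

/-! ### Banach lattices and `σ`-order continuous positive operators -/

/-- A (real) Banach lattice. -/
structure BanLat : Type (u + 1) where
  carrier : Type u
  [normedAddCommGroup : NormedAddCommGroup carrier]
  [normedSpace : NormedSpace ℝ carrier]
  [lattice : Lattice carrier]
  [isOrderedAddMonoid : IsOrderedAddMonoid carrier]
  [isOrderedModule : IsOrderedModule ℝ carrier]
  [hasSolidNorm : HasSolidNorm carrier]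
  [completeSpace : CompleteSpace carrier]

namespace BanLat

attribute [instance] normedAddCommGroup normedSpace lattice isOrderedAddMonoid isOrderedModule
  hasSolidNorm completeSpace

instance : CoeSort BanLat (Type u) := ⟨BanLat.carrier⟩

/-- A `σ`-order continuous positive linear operator between Banach lattices: positive vectors are
sent to positive vectors, and if `v n ↑ x` then `T x = ⋁ T (v n)`. -/
@[ext]
structure Hom (V W : BanLat.{u}) where
  toLinearMap : V →ₗ[ℝ] W
  pos : ∀ v : V, 0 ≤ v → 0 ≤ toLinearMap v
  map_isLUB : ∀ (v : ℕ → V) (x : V), Monotone v → IsLUB (Set.range v) x →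
    IsLUB (Set.range fun n => toLinearMap (v n)) (toLinearMap x)

theorem Hom.mono {V W : BanLat.{u}} (T : Hom V W) : Monotone T.toLinearMap := by
  intro a b h
  have := T.pos (b - a) (sub_nonneg.2 h)
  rwa [map_sub, sub_nonneg] at this

/-- The category `BL_σ` of Banach lattices and `σ`-order continuous positive operators. -/
instance : Category BanLat.{u} where
  Hom := Hom
  id V := ⟨LinearMap.id, fun _ h => h, fun _ _ _ h => h⟩
  comp S T := ⟨T.toLinearMap ∘ₗ S.toLinearMap, fun v h => T.pos _ (S.pos v h),
    fun v x hv hx => T.map_isLUB _ _ (S.mono.comp hv) (S.map_isLUB v x hv hx)⟩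

instance {V W : BanLat.{u}} : CoeFun (V ⟶ W) (fun _ => V → W) := ⟨fun T => T.toLinearMap⟩

@[ext]
theorem hom_ext {V W : BanLat.{u}} {S T : V ⟶ W} (h : ∀ v, S v = T v) : S = T :=
  Hom.ext (LinearMap.ext h)

@[simp] theorem id_apply {V : BanLat.{u}} (v : V) : (𝟙 V : V ⟶ V) v = v := rfl

@[simp] theorem comp_apply {U V W : BanLat.{u}} (S : U ⟶ V) (T : V ⟶ W) (v : U) :
    (S ≫ T) v = T (S v) := rfl

/-- Positive operators between Banach lattices are norm-continuous. -/
theorem Hom.continuous {V W : BanLat.{u}} (T : Hom V W) : Continuous T.toLinearMap := by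
  have habs : ∀ v : V, |T.toLinearMap v| ≤ T.toLinearMap |v| := fun v => by
    refine abs_le'.2 ⟨T.mono (le_abs_self v), ?_⟩
    rw [← map_neg]
    exact T.mono (neg_le_abs v)
  suffices h : ∃ C : ℝ, ∀ v, ‖T.toLinearMap v‖ ≤ C * ‖v‖ by
    obtain ⟨C, hC⟩ := h
    exact (T.toLinearMap.mkContinuous C hC).continuous
  by_contra! hcon
  have key : ∀ n : ℕ, ∃ v : V, 0 ≤ v ∧ ‖v‖ ≤ (1 / 2 : ℝ) ^ n ∧ (n : ℝ) < ‖T.toLinearMap v‖ := by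
    intro n
    obtain ⟨v, hv⟩ := hcon (n * 2 ^ n)
    have hv0 : 0 < ‖v‖ := by
      rcases (norm_nonneg v).eq_or_lt with h | h
      · rw [← h, norm_eq_zero.1 h.symm] at hv
        simp at hv
      · exact h
    have hc : 0 ≤ (‖v‖⁻¹ * (1 / 2 : ℝ) ^ n) := by positivity
    refine ⟨(‖v‖⁻¹ * (1 / 2 : ℝ) ^ n) • |v|, smul_nonneg hc (abs_nonneg v), ?_, ?_⟩
    · rw [norm_smul, norm_abs_eq_norm, Real.norm_of_nonneg hc]
      rw [mul_right_comm, inv_mul_cancel₀ hv0.ne', one_mul]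
    · rw [map_smul, norm_smul, Real.norm_of_nonneg hc]
      have h1 : ‖T.toLinearMap v‖ ≤ ‖T.toLinearMap |v|‖ :=
        norm_le_norm_of_abs_le_abs ((habs v).trans (le_abs_self _))
      have h2 : (n : ℝ) = (‖v‖⁻¹ * (1 / 2 : ℝ) ^ n) * (n * 2 ^ n * ‖v‖) := by
        have : (1 / 2 : ℝ) ^ n * 2 ^ n = 1 := by rw [← mul_pow]; norm_num
        calc (n : ℝ) = n * ((1 / 2 : ℝ) ^ n * 2 ^ n) * (‖v‖⁻¹ * ‖v‖) := by
              rw [this, inv_mul_cancel₀ hv0.ne']; ring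
          _ = _ := by ring
      calc (n : ℝ) = _ := h2
        _ < (‖v‖⁻¹ * (1 / 2 : ℝ) ^ n) * ‖T.toLinearMap |v|‖ := by
          have : 0 < ‖v‖⁻¹ * (1 / 2 : ℝ) ^ n := by positivity
          exact mul_lt_mul_of_pos_left (hv.trans_le h1) this
  choose v hv0 hvn hvT using key
  have hs : Summable v := Summable.of_norm_bounded summable_geometric_two hvn
  obtain ⟨n, hn⟩ := exists_nat_gt ‖T.toLinearMap (∑' i, v i)‖
  have hle : v n ≤ ∑' i, v i := hs.le_tsum n fun j _ => hv0 j
  have h3 : ‖T.toLinearMap (v n)‖ ≤ ‖T.toLinearMap (∑' i, v i)‖ := by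
    apply norm_le_norm_of_abs_le_abs
    rw [abs_of_nonneg (T.pos _ (hv0 n)), abs_of_nonneg (T.pos _ ((hv0 n).trans hle))]
    exact T.mono hle
  linarith [hvT n]

end BanLat

/-! ### The `σ`-order dual -/

section Dual

variable (V : Type u) [NormedAddCommGroup V] [NormedSpace ℝ V]

/-- The `σ`-order continuous functionals: `F (v n) → 0` whenever `v n ↓ 0`. On a Banach lattice the
norm-continuous functionals are exactly the order bounded ones. -/
def sigmaDualSubmodule [Lattice V] : Submodule ℝ (StrongDual ℝ V) where
  carrier := {F | ∀ v : ℕ → V, Antitone v → IsGLB (Set.range v) 0 →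
    Tendsto (fun n => F (v n)) atTop (𝓝 0)}
  zero_mem' := fun v _ _ => by simp
  add_mem' := fun {F G} hF hG v h1 h2 => by simpa using (hF v h1 h2).add (hG v h1 h2)
  smul_mem' := fun c F hF v h1 h2 => by simpa using (hF v h1 h2).const_mul c

/-- The `σ`-order dual (Köthe dual) of a Banach lattice, with the norm of the norm-dual. -/
def SigmaDual [Lattice V] : Type u := sigmaDualSubmodule V

variable [Lattice V]

noncomputable instance : NormedAddCommGroup (SigmaDual V) :=
  inferInstanceAs (NormedAddCommGroup (sigmaDualSubmodule V))

noncomputable instance : NormedSpace ℝ (SigmaDual V) :=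
  inferInstanceAs (NormedSpace ℝ (sigmaDualSubmodule V))

variable {V}

/-- The underlying continuous functional. -/
def SigmaDual.val (F : SigmaDual V) : StrongDual ℝ V := Subtype.val F

instance : CoeFun (SigmaDual V) (fun _ => V → ℝ) := ⟨fun F => F.val⟩

namespace SigmaDual

theorem tendsto (F : SigmaDual V) (v : ℕ → V) (hv : Antitone v) (h : IsGLB (Set.range v) 0) :
    Tendsto (fun n => F (v n)) atTop (𝓝 0) := Subtype.property F v hv h

@[simp] theorem add_apply (F G : SigmaDual V) (v : V) : (F + G) v = F v + G v := rfl
@[simp] theorem sub_apply (F G : SigmaDual V) (v : V) : (F - G) v = F v - G v := rfl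
@[simp] theorem neg_apply (F : SigmaDual V) (v : V) : (-F) v = -F v := rfl
@[simp] theorem zero_apply (v : V) : (0 : SigmaDual V) v = 0 := rfl
@[simp] theorem smul_apply (c : ℝ) (F : SigmaDual V) (v : V) : (c • F) v = c * F v := rfl
theorem norm_eq (F : SigmaDual V) : ‖F‖ = ‖F.val‖ := rfl
theorem abs_apply_le (F : SigmaDual V) (v : V) : |F v| ≤ ‖F‖ * ‖v‖ := F.val.le_opNorm v

theorem ext {F G : SigmaDual V} (h : ∀ v, F v = G v) : F = G :=
  Subtype.ext (ContinuousLinearMap.ext h)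

variable [IsOrderedAddMonoid V]

theorem ext_nonneg {F G : SigmaDual V} (h : ∀ v, 0 ≤ v → F v = G v) : F = G := by
  refine ext fun v => ?_
  rw [← posPart_sub_negPart v, map_sub, map_sub, h _ (posPart_nonneg v), h _ (negPart_nonneg v)]

/-- The order of the dual: `F ≤ G` iff `F v ≤ G v` for all positive `v`. -/
instance : PartialOrder (SigmaDual V) where
  le F G := ∀ v : V, 0 ≤ v → F v ≤ G v
  le_refl _ _ _ := le_rfl
  le_trans _ _ _ h1 h2 v hv := (h1 v hv).trans (h2 v hv)
  le_antisymm _ _ h1 h2 := ext_nonneg fun v hv => le_antisymm (h1 v hv) (h2 v hv)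

theorem le_def {F G : SigmaDual V} : F ≤ G ↔ ∀ v : V, 0 ≤ v → F v ≤ G v := Iff.rfl

instance : IsOrderedAddMonoid (SigmaDual V) where
  add_le_add_left F G h H v hv := by simpa using h v hv

instance : IsOrderedModule ℝ (SigmaDual V) :=
  IsOrderedModule.of_smul_nonneg fun c hc F hF v hv => mul_nonneg hc (hF v hv)

theorem mono_of_nonneg {F : SigmaDual V} (hF : 0 ≤ F) {a b : V} (h : a ≤ b) : F a ≤ F b := by
  have := hF (b - a) (sub_nonneg.2 h)
  rw [map_sub] at this
  simpa using this

/-- A sequence decreasing to zero stays so after taking infima with a fixed positive vector. -/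
theorem isGLB_inf {v : ℕ → V} (h : IsGLB (Set.range v) 0) {u : V} (hu : 0 ≤ u) :
    IsGLB (Set.range fun n => u ⊓ v n) 0 := by
  constructor
  · rintro _ ⟨n, rfl⟩
    exact le_inf hu (h.1 ⟨n, rfl⟩)
  · intro w hw
    refine h.2 ?_
    rintro _ ⟨n, rfl⟩
    exact (hw ⟨n, rfl⟩).trans inf_le_right

variable [HasSolidNorm V]

theorem norm_le_of_le {a b : V} (ha : 0 ≤ a) (h : a ≤ b) : ‖a‖ ≤ ‖b‖ :=
  norm_le_norm_of_abs_le_abs (by rwa [abs_of_nonneg ha, abs_of_nonneg (ha.trans h)])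

/-- The values `F u`, `0 ≤ u ≤ v`. -/
def below (F : SigmaDual V) (v : V) : Set ℝ := {r | ∃ u, 0 ≤ u ∧ u ≤ v ∧ F u = r}

theorem below_bdd (F : SigmaDual V) {v : V} {r : ℝ} (hr : r ∈ below F v) :
    |r| ≤ ‖F‖ * ‖v‖ := by
  obtain ⟨u, h0, hu, rfl⟩ := hr
  exact (abs_apply_le F u).trans (by gcongr; exact norm_le_of_le h0 hu)

theorem bddAbove_below (F : SigmaDual V) (v : V) : BddAbove (below F v) :=
  ⟨‖F‖ * ‖v‖, fun _ hr => (le_abs_self _).trans (below_bdd F hr)⟩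

theorem zero_mem_below (F : SigmaDual V) {v : V} (hv : 0 ≤ v) : (0 : ℝ) ∈ below F v :=
  ⟨0, le_rfl, hv, map_zero _⟩

/-- `v ↦ sup {F u | 0 ≤ u ≤ v}` (Riesz–Kantorovich). -/
noncomputable def posVal (F : SigmaDual V) (v : V) : ℝ := sSup (below F v)

theorem posVal_nonneg (F : SigmaDual V) {v : V} (hv : 0 ≤ v) : 0 ≤ posVal F v :=
  le_csSup (bddAbove_below F v) (zero_mem_below F hv)

theorem le_posVal (F : SigmaDual V) {u v : V} (hu : 0 ≤ u) (h : u ≤ v) : F u ≤ posVal F v :=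
  le_csSup (bddAbove_below F v) ⟨u, hu, h, rfl⟩

theorem posVal_le (F : SigmaDual V) {v : V} (hv : 0 ≤ v) : posVal F v ≤ ‖F‖ * ‖v‖ :=
  csSup_le ⟨0, zero_mem_below F hv⟩ fun _ hr => (le_abs_self _).trans (below_bdd F hr)

theorem posVal_add (F : SigmaDual V) {v w : V} (hv : 0 ≤ v) (hw : 0 ≤ w) :
    posVal F (v + w) = posVal F v + posVal F w := by
  apply le_antisymm
  · refine csSup_le ⟨0, zero_mem_below F (add_nonneg hv hw)⟩ ?_
    rintro _ ⟨u, h0, hu, rfl⟩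
    have h1 : F (u ⊓ v) ≤ posVal F v := le_posVal F (le_inf h0 hv) inf_le_right
    have h2 : F (u - u ⊓ v) ≤ posVal F w := by
      refine le_posVal F (sub_nonneg.2 inf_le_left) ?_
      rw [sub_le_iff_le_add, add_inf]
      exact le_inf (by simpa using hw) (by rwa [add_comm])
    rw [map_sub] at h2
    linarith
  · have : ∀ a ∈ below F v, ∀ b ∈ below F w, a + b ≤ posVal F (v + w) := by
      rintro _ ⟨u, h0, hu, rfl⟩ _ ⟨u', h0', hu', rfl⟩
      rw [← map_add]
      exact le_posVal F (add_nonneg h0 h0') (add_le_add hu hu')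
    have h1 : ∀ b ∈ below F w, posVal F v ≤ posVal F (v + w) - b := fun b hb =>
      csSup_le ⟨0, zero_mem_below F hv⟩ fun a ha => by linarith [this a ha b hb]
    have h2 : posVal F w ≤ posVal F (v + w) - posVal F v :=
      csSup_le ⟨0, zero_mem_below F hw⟩ fun b hb => by linarith [h1 b hb]
    linarith

variable (F : SigmaDual V)

/-- The additive extension of `posVal F` from the positive cone. -/
noncomputable def posHom : V →+ ℝ where
  toFun v := posVal F v⁺ - posVal F v⁻
  map_zero' := by simp
  map_add' v w := by
    have h : (v + w)⁺ + (v⁻ + w⁻) = (v⁺ + w⁺) + (v + w)⁻ := by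
      have h1 := posPart_sub_negPart v
      have h2 := posPart_sub_negPart w
      have h3 := posPart_sub_negPart (v + w)
      have h4 : (v + w)⁺ - (v + w)⁻ = (v⁺ - v⁻) + (w⁺ - w⁻) := by rw [h1, h2, h3]
      have h5 : (v + w)⁺ = (v⁺ - v⁻) + (w⁺ - w⁻) + (v + w)⁻ := by rw [← h4]; abel
      rw [h5]; abel
    have h' := congrArg (posVal F) h
    have p := fun x : V => posPart_nonneg x
    have n := fun x : V => negPart_nonneg x
    rw [posVal_add F (p _) (add_nonneg (n _) (n _)), posVal_add F (n _) (n _),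
      posVal_add F (add_nonneg (p _) (p _)) (n _), posVal_add F (p _) (p _)] at h'
    linarith

theorem abs_posHom_le (v : V) : |posHom F v| ≤ ‖F‖ * ‖v‖ := by
  have hp : ‖v⁺‖ ≤ ‖v‖ := norm_le_norm_of_abs_le_abs (by
    rw [abs_of_nonneg (posPart_nonneg v), ← posPart_add_negPart v]
    exact le_add_of_nonneg_right (negPart_nonneg v))
  have hn : ‖v⁻‖ ≤ ‖v‖ := norm_le_norm_of_abs_le_abs (by
    rw [abs_of_nonneg (negPart_nonneg v), ← posPart_add_negPart v]
    exact le_add_of_nonneg_left (posPart_nonneg v))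
  have h1 := posVal_nonneg F (posPart_nonneg v)
  have h2 := posVal_nonneg F (negPart_nonneg v)
  have h3 := (posVal_le F (posPart_nonneg v)).trans (mul_le_mul_of_nonneg_left hp (norm_nonneg F))
  have h4 := (posVal_le F (negPart_nonneg v)).trans (mul_le_mul_of_nonneg_left hn (norm_nonneg F))
  change |posVal F v⁺ - posVal F v⁻| ≤ _
  rw [abs_le]
  constructor <;> linarith

/-- The positive part as a continuous functional. -/
noncomputable def posCLM : StrongDual ℝ V :=
  (posHom F).toRealLinearMap (AddMonoidHomClass.continuous_of_bound (posHom F) ‖F‖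
    fun v => abs_posHom_le F v)

theorem posCLM_apply {v : V} (hv : 0 ≤ v) : posCLM F v = posVal F v := by
  change posVal F v⁺ - posVal F v⁻ = _
  rw [posPart_of_nonneg hv, negPart_of_nonneg hv]
  have : posVal F (0 + 0 : V) = _ := posVal_add F le_rfl le_rfl
  rw [add_zero] at this
  linarith

/-- The positive part of a `σ`-order continuous functional. -/
noncomputable def pos : SigmaDual V := ⟨posCLM F, by
  intro v hv h
  have hv0 : ∀ n, 0 ≤ v n := fun n => h.1 ⟨n, rfl⟩
  have hmono : ∀ {a b : V}, 0 ≤ a → a ≤ b → posVal F b = posVal F a + posVal F (b - a) :=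
    fun {a b} ha hab => by
      rw [← posVal_add F ha (sub_nonneg.2 hab), add_sub_cancel]
  simp only [posCLM_apply F (hv0 _)]
  rw [Metric.tendsto_atTop]
  intro ε hε
  obtain ⟨_, ⟨u, hu0, hu, rfl⟩, hlt⟩ :=
    exists_lt_of_lt_csSup ⟨0, zero_mem_below F (hv0 0)⟩
      (show posVal F (v 0) - ε / 2 < sSup (below F (v 0)) by
        change posVal F (v 0) - ε / 2 < posVal F (v 0); linarith)
  have ht := F.tendsto (fun n => u ⊓ v n) (fun m n hmn => inf_le_inf_left _ (hv hmn))
    (isGLB_inf h hu0)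
  obtain ⟨N, hN⟩ := (Metric.tendsto_atTop.1 ht) (ε / 2) (half_pos hε)
  refine ⟨N, fun n hn => ?_⟩
  have h1 := hN n hn
  rw [Real.dist_eq, sub_zero] at h1 ⊢
  rw [abs_of_nonneg (posVal_nonneg F (hv0 n))]
  have h2 : F (u - u ⊓ v n) ≤ posVal F (v 0 - v n) := by
    refine le_posVal F (sub_nonneg.2 inf_le_left) ?_
    rw [sub_le_iff_le_add, add_inf]
    refine le_inf ?_ (by rwa [sub_add_cancel])
    have := hv (Nat.zero_le n)
    simpa using this
  rw [map_sub] at h2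
  have h3 := hmono (hv0 n) (hv (Nat.zero_le n))
  have h4 := le_abs_self (F (u ⊓ v n))
  linarith⟩

theorem pos_apply {v : V} (hv : 0 ≤ v) : pos F v = posVal F v := posCLM_apply F hv

/-- The lattice operations of the order of the dual, given by the Riesz–Kantorovich formula. -/
noncomputable instance : Lattice (SigmaDual V) where
  sup F G := G + pos (F - G)
  le_sup_left F G v hv := by
    have := le_posVal (F - G) hv le_rfl
    rw [add_apply, pos_apply _ hv]
    rw [sub_apply] at this
    linarith
  le_sup_right F G v hv := by
    rw [add_apply, pos_apply _ hv]
    linarith [posVal_nonneg (F - G) hv]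
  sup_le F G H hF hG v hv := by
    rw [add_apply, pos_apply _ hv]
    have : posVal (F - G) v ≤ H v - G v := by
      refine csSup_le ⟨0, zero_mem_below _ hv⟩ ?_
      rintro _ ⟨u, h0, hu, rfl⟩
      have h1 := hF u h0
      have h2 := hG (v - u) (sub_nonneg.2 hu)
      rw [map_sub, map_sub] at h2
      rw [sub_apply]
      linarith
    linarith
  inf F G := F - pos (F - G)
  inf_le_left F G v hv := by
    rw [sub_apply, pos_apply _ hv]
    linarith [posVal_nonneg (F - G) hv]
  inf_le_right F G v hv := by
    have := le_posVal (F - G) hv le_rfl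
    rw [sub_apply, pos_apply _ hv]
    rw [sub_apply] at this
    linarith
  le_inf H F G hF hG v hv := by
    rw [sub_apply, pos_apply _ hv]
    have : posVal (F - G) v ≤ F v - H v := by
      refine csSup_le ⟨0, zero_mem_below _ hv⟩ ?_
      rintro _ ⟨u, h0, hu, rfl⟩
      have h1 := hF (v - u) (sub_nonneg.2 hu)
      have h2 := hG u h0
      rw [map_sub, map_sub] at h1
      rw [sub_apply]
      linarith
    linarith

theorem abs_apply_nonneg_le {v : V} (hv : 0 ≤ v) : |F| v ≤ ‖F‖ * ‖v‖ := by
  change (-F + pos (F - -F)) v ≤ _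
  rw [add_apply, pos_apply _ hv]
  have : posVal (F - -F) v ≤ ‖F‖ * ‖v‖ + F v := by
    refine csSup_le ⟨0, zero_mem_below _ hv⟩ ?_
    rintro _ ⟨u, h0, hu, rfl⟩
    have h1 := (le_abs_self _).trans (abs_apply_le F (u + u - v))
    have h2 : ‖u + u - v‖ ≤ ‖v‖ := by
      refine norm_le_norm_of_abs_le_abs ?_
      rw [abs_of_nonneg hv]
      refine abs_le'.2 ⟨?_, ?_⟩
      · rw [sub_le_iff_le_add]; exact add_le_add hu hu
      · rw [neg_sub, sub_le_self_iff]; exact add_nonneg h0 h0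
    have h3 := h1.trans (mul_le_mul_of_nonneg_left h2 (norm_nonneg F))
    rw [map_sub, map_add] at h3
    rw [sub_apply, neg_apply]
    linarith
  rw [neg_apply]
  linarith

theorem abs_le_abs_apply (v : V) : |F v| ≤ |F| |v| := by
  have hp := posPart_nonneg v
  have hn := negPart_nonneg v
  have h1 := (le_abs_self F) _ hp
  have h2 := (le_abs_self F) _ hn
  have h3 := (neg_le_abs F) _ hp
  have h4 := (neg_le_abs F) _ hn
  have h5 : F v = F v⁺ - F v⁻ := by rw [← map_sub, posPart_sub_negPart]
  have h6 : |F| |v| = |F| v⁺ + |F| v⁻ := by rw [← map_add, posPart_add_negPart]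
  rw [neg_apply] at h3 h4
  rw [h5, h6, abs_le]
  constructor <;> linarith

instance : HasSolidNorm (SigmaDual V) where
  solid F G h := by
    refine ContinuousLinearMap.opNorm_le_bound _ (norm_nonneg G) fun v => ?_
    calc |F v| ≤ |F| |v| := abs_le_abs_apply F v
      _ ≤ |G| |v| := h _ (abs_nonneg v)
      _ ≤ ‖G‖ * ‖|v|‖ := abs_apply_nonneg_le G (abs_nonneg v)
      _ = ‖G‖ * ‖v‖ := by rw [norm_abs_eq_norm]

instance : CompleteSpace (SigmaDual V) := by
  have hcl : IsClosed (sigmaDualSubmodule V : Set (StrongDual ℝ V)) := by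
    refine isClosed_of_closure_subset fun F hF v hv h => ?_
    have hv0 : ∀ n, 0 ≤ v n := fun n => h.1 ⟨n, rfl⟩
    rw [Metric.tendsto_atTop]
    intro ε hε
    have hd : 0 < ε / (2 * (‖v 0‖ + 1)) := by positivity
    obtain ⟨G, hG, hFG⟩ := Metric.mem_closure_iff.1 hF _ hd
    obtain ⟨N, hN⟩ := (Metric.tendsto_atTop.1 (hG v hv h)) (ε / 2) (half_pos hε)
    refine ⟨N, fun n hn => ?_⟩
    have h1 := hN n hn
    rw [Real.dist_eq, sub_zero] at h1 ⊢
    have h2 : |(F - G) (v n)| ≤ ‖F - G‖ * ‖v n‖ := (F - G).le_opNorm (v n)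
    have h3 : ‖v n‖ ≤ ‖v 0‖ + 1 :=
      (norm_le_of_le (hv0 n) (hv (Nat.zero_le n))).trans (by linarith)
    rw [dist_eq_norm] at hFG
    have h4 : ‖F - G‖ * ‖v n‖ ≤ ε / (2 * (‖v 0‖ + 1)) * (‖v 0‖ + 1) :=
      mul_le_mul hFG.le h3 (norm_nonneg _) hd.le
    have h5 : ε / (2 * (‖v 0‖ + 1)) * (‖v 0‖ + 1) = ε / 2 := by
      have : ‖v 0‖ + 1 ≠ 0 := by positivity
      field_simp
    have h6 : F (v n) = (F - G) (v n) + G (v n) := by simp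
    rw [h6]
    linarith [abs_add_le ((F - G) (v n)) (G (v n))]
  exact hcl.completeSpace_coe

/-- Suprema of increasing sequences in the `σ`-order dual are pointwise on the positive cone. -/
theorem tendsto_of_isLUB {F : ℕ → SigmaDual V} {G : SigmaDual V} (hF : Monotone F)
    (hG : IsLUB (Set.range F) G) {v : V} (hv : 0 ≤ v) :
    Tendsto (fun n => F n v) atTop (𝓝 (G v)) := by
  have hFG : ∀ n, F n ≤ G := fun n => hG.1 ⟨n, rfl⟩
  have hlim : ∀ w : V, ∃ r, Tendsto (fun n => F n w) atTop (𝓝 r) := by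
    have h0 : ∀ w : V, 0 ≤ w → ∃ r, Tendsto (fun n => F n w) atTop (𝓝 r) := fun w hw =>
      ⟨_, tendsto_atTop_ciSup (fun m n hmn => hF hmn w hw)
        ⟨G w, by rintro _ ⟨n, rfl⟩; exact hFG n w hw⟩⟩
    intro w
    obtain ⟨a, ha⟩ := h0 _ (posPart_nonneg w)
    obtain ⟨b, hb⟩ := h0 _ (negPart_nonneg w)
    refine ⟨a - b, (ha.sub hb).congr fun n => ?_⟩
    rw [← map_sub, posPart_sub_negPart]
  choose L hL using hlim
  let L' : V →ₗ[ℝ] ℝ := linearMapOfTendsto L (fun n => (F n).val.toLinearMap)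
    (tendsto_pi_nhds.2 hL)
  have hL0 : ∀ w : V, 0 ≤ w → F 0 w ≤ L w := fun w hw =>
    ge_of_tendsto' (hL w) fun n => hF (Nat.zero_le n) w hw
  have hLG : ∀ w : V, 0 ≤ w → L w ≤ G w := fun w hw =>
    le_of_tendsto' (hL w) fun n => hFG n w hw
  have hb : ∀ w : V, ‖L' w‖ ≤ ((‖F 0‖ + ‖G‖) * 2) * ‖w‖ := by
    have h0 : ∀ w : V, 0 ≤ w → |L w| ≤ (‖F 0‖ + ‖G‖) * ‖w‖ := fun w hw => by
      have h1 := abs_le.1 (abs_apply_le (F 0) w)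
      have h2 := abs_le.1 (abs_apply_le G w)
      have h3 : 0 ≤ ‖F 0‖ * ‖w‖ := by positivity
      have h4 : 0 ≤ ‖G‖ * ‖w‖ := by positivity
      rw [abs_le, add_mul]
      constructor <;> linarith [hL0 w hw, hLG w hw]
    intro w
    have e : L' w = L w⁺ - L w⁻ := by
      rw [← posPart_sub_negPart w, map_sub, posPart_sub_negPart]; rfl
    have h1 := h0 _ (posPart_nonneg w)
    have h2 := h0 _ (negPart_nonneg w)
    have hp : ‖w⁺‖ ≤ ‖w‖ := norm_le_norm_of_abs_le_abs (by
      rw [abs_of_nonneg (posPart_nonneg w), ← posPart_add_negPart w]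
      exact le_add_of_nonneg_right (negPart_nonneg w))
    have hn : ‖w⁻‖ ≤ ‖w‖ := norm_le_norm_of_abs_le_abs (by
      rw [abs_of_nonneg (negPart_nonneg w), ← posPart_add_negPart w]
      exact le_add_of_nonneg_left (posPart_nonneg w))
    have h3 : (‖F 0‖ + ‖G‖) * ‖w⁺‖ ≤ (‖F 0‖ + ‖G‖) * ‖w‖ := by gcongr
    have h4 : (‖F 0‖ + ‖G‖) * ‖w⁻‖ ≤ (‖F 0‖ + ‖G‖) * ‖w‖ := by gcongr
    rw [e, Real.norm_eq_abs]
    have := abs_sub (L w⁺) (L w⁻)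
    linarith
  let H : SigmaDual V := ⟨L'.mkContinuous _ hb, by
    intro w hw h
    have hw0 : ∀ n, 0 ≤ w n := fun n => h.1 ⟨n, rfl⟩
    exact tendsto_of_tendsto_of_tendsto_of_le_of_le ((F 0).tendsto w hw h) (G.tendsto w hw h)
      (fun n => hL0 _ (hw0 n)) (fun n => hLG _ (hw0 n))⟩
  have hH : G ≤ H := hG.2 (by
    rintro _ ⟨n, rfl⟩ w hw
    exact Monotone.ge_of_tendsto (fun m n hmn => hF hmn w hw) (hL w) n)
  have : G v = L v := le_antisymm (hH v hv) (hLG v hv)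
  rw [this]
  exact hL v

end SigmaDual

end Dual

/-- The `σ`-order dual as an object of `BL_σ`. -/
noncomputable def BanLat.sigmaDualObj (V : BanLat.{u}) : BanLat.{u} := ⟨SigmaDual V⟩

/-- The transpose `F ↦ F ∘ T` between `σ`-order duals. -/
noncomputable def BanLat.sigmaDualMap {V W : BanLat.{u}} (T : V ⟶ W) :
    W.sigmaDualObj ⟶ V.sigmaDualObj where
  toLinearMap :=
    { toFun := fun F : SigmaDual W =>
        (⟨F.val.comp ⟨T.toLinearMap, T.continuous⟩, by
          intro v hv h
          refine F.tendsto (fun n => T (v n)) (fun m n hmn => T.mono (hv hmn)) ?_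
          have h1 := T.map_isLUB (fun n => -v n) 0 (fun m n hmn => neg_le_neg (hv hmn)) (by
            constructor
            · rintro _ ⟨n, rfl⟩
              exact neg_nonpos.2 (h.1 ⟨n, rfl⟩)
            · intro w hw
              have := h.2 (show -w ∈ lowerBounds (Set.range v) by
                rintro _ ⟨n, rfl⟩
                exact neg_le.1 (hw ⟨n, rfl⟩))
              exact neg_nonpos.1 this)
          rw [map_zero] at h1
          constructor
          · rintro _ ⟨n, rfl⟩
            have := h1.1 ⟨n, rfl⟩
            simpa using this
          · intro w hw
            have := h1.2 (show -w ∈ upperBounds _ by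
              rintro _ ⟨n, rfl⟩
              have := hw ⟨n, rfl⟩
              simpa using this)
            simpa using this⟩ : SigmaDual V)
      map_add' := fun F G => rfl
      map_smul' := fun c F => rfl }
  pos F hF v hv := hF _ (T.pos v hv)
  map_isLUB F G hF hG := by
    constructor
    · rintro _ ⟨n, rfl⟩ v hv
      exact hG.1 ⟨n, rfl⟩ _ (T.pos v hv)
    · intro H hH v hv
      exact le_of_tendsto' (SigmaDual.tendsto_of_isLUB (V := W) hF hG (T.pos v hv)) fun n =>
        hH ⟨n, rfl⟩ v hv

/-- The contravariant functor `(-)^σ` on `BL_σ`, acting on morphisms by pre-composition. -/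
noncomputable def sigmaDual : BanLat.{u}ᵒᵖ ⥤ BanLat.{u} where
  obj V := V.unop.sigmaDualObj
  map T := BanLat.sigmaDualMap T.unop

/-! ### The category of Borel kernels and its dagger -/

/-- A measured standard Borel space: a standard Borel space with a probability measure. -/
structure Krn : Type (u + 1) where
  carrier : Type u
  [measurableSpace : MeasurableSpace carrier]
  [standardBorel : StandardBorelSpace carrier]
  measure : Measure carrier
  [isProbabilityMeasure : IsProbabilityMeasure measure]

namespace Krn

attribute [instance] measurableSpace standardBorel isProbabilityMeasure

instance : CoeSort Krn (Type u) := ⟨Krn.carrier⟩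

instance (X : Krn.{u}) : Nonempty X := nonempty_of_isProbabilityMeasure X.measure

/-- A Markov kernel `f` from `X` to `Y` which sends the measure of `X` to the measure of `Y`. -/
structure Arrow (X Y : Krn.{u}) where
  kernel : Kernel X Y
  [isMarkovKernel : IsMarkovKernel kernel]
  comp_measure : kernel ∘ₘ X.measure = Y.measure

attribute [instance] Arrow.isMarkovKernel

/-- Arrows are identified when they disagree only on a null set of the domain. -/
instance arrowSetoid (X Y : Krn.{u}) : Setoid (Arrow X Y) where
  r f g := X.measure {x | f.kernel x ≠ g.kernel x} = 0
  iseqv :=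
    { refl := fun f => by simp
      symm := fun {f g} h => by simpa only [ne_comm] using h
      trans := fun {f g h} h1 h2 => by
        change ∀ᵐ x ∂X.measure, f.kernel x = g.kernel x at h1
        change ∀ᵐ x ∂X.measure, g.kernel x = h.kernel x at h2
        change ∀ᵐ x ∂X.measure, f.kernel x = h.kernel x
        filter_upwards [h1, h2] with x e1 e2 using e1.trans e2 }

theorem arrow_equiv_iff {X Y : Krn.{u}} {f g : Arrow X Y} :
    f ≈ g ↔ f.kernel =ᵐ[X.measure] g.kernel := Iff.rfl

/-- The identity (Dirac) kernel. -/
noncomputable def Arrow.id (X : Krn.{u}) : Arrow X X := ⟨Kernel.id, by simp⟩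

/-- Kleisli composition. -/
noncomputable def Arrow.comp {X Y Z : Krn.{u}} (f : Arrow X Y) (g : Arrow Y Z) : Arrow X Z :=
  ⟨g.kernel ∘ₖ f.kernel, by rw [← Measure.comp_assoc, f.comp_measure, g.comp_measure]⟩

theorem Arrow.comp_congr {X Y Z : Krn.{u}} {f f' : Arrow X Y} {g g' : Arrow Y Z}
    (hf : f ≈ f') (hg : g ≈ g') : f.comp g ≈ f'.comp g' := by
  rw [arrow_equiv_iff] at *
  rw [← f.comp_measure] at hg
  filter_upwards [hf, Measure.ae_ae_of_ae_comp hg] with x h1 h2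
  change (g.kernel ∘ₖ f.kernel) x = (g'.kernel ∘ₖ f'.kernel) x
  rw [Kernel.comp_apply, Kernel.comp_apply, ← h1]
  exact Measure.comp_congr h2

/-- The category of Borel kernels: morphisms are measure-preserving Markov kernels up to almost
everywhere equality. -/
noncomputable instance : Category Krn.{u} where
  Hom X Y := Quotient (arrowSetoid X Y)
  id X := Quotient.mk _ (Arrow.id X)
  comp := Quotient.map₂ Arrow.comp fun _ _ hf _ _ hg => Arrow.comp_congr hf hg
  id_comp := by
    rintro X Y ⟨f⟩
    exact Quotient.sound (arrow_equiv_iff.2 (by simp [Arrow.comp, Arrow.id]))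
  comp_id := by
    rintro X Y ⟨f⟩
    exact Quotient.sound (arrow_equiv_iff.2 (by simp [Arrow.comp, Arrow.id]))
  assoc := by
    rintro X Y Z W ⟨f⟩ ⟨g⟩ ⟨h⟩
    exact Quotient.sound (arrow_equiv_iff.2 (by simp [Arrow.comp, Kernel.comp_assoc]))

/-- The morphism of an arrow. -/
def Arrow.toHom {X Y : Krn.{u}} (f : Arrow X Y) : X ⟶ Y := Quotient.mk (arrowSetoid X Y) f

theorem Arrow.toHom_eq {X Y : Krn.{u}} {f g : Arrow X Y}
    (h : f.kernel =ᵐ[X.measure] g.kernel) : f.toHom = g.toHom := Quotient.sound h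

/-- The Bayesian inverse of an arrow: the kernel `f†` with
`∫ x in A, f x B ∂μ = ∫ y in B, f† y A ∂ν`. -/
noncomputable def Arrow.dagger {X Y : Krn.{u}} (f : Arrow X Y) : Arrow Y X :=
  ⟨f.kernel†X.measure, by
    have h := posterior_comp_self (κ := f.kernel) (μ := X.measure)
    rwa [f.comp_measure] at h⟩

theorem Arrow.dagger_spec {X Y : Krn.{u}} (f : Arrow X Y) {A : Set X} {B : Set Y}
    (hA : MeasurableSet A) (hB : MeasurableSet B) :
    ∫⁻ x in A, f.kernel x B ∂X.measure = ∫⁻ y in B, f.dagger.kernel y A ∂Y.measure := by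
  have h := compProd_posterior_eq_map_swap (κ := f.kernel) (μ := X.measure)
  rw [f.comp_measure] at h
  have h2 := congrArg (fun m => m (B ×ˢ A)) h
  rw [Measure.compProd_apply_prod hB hA, Measure.map_apply measurable_swap (hB.prod hA),
    Set.preimage_swap_prod, Measure.compProd_apply_prod hA hB] at h2
  exact h2.symm

/-- The dagger on morphisms. -/
noncomputable def daggerHom {X Y : Krn.{u}} : (X ⟶ Y) → (Y ⟶ X) :=
  Quotient.map Arrow.dagger fun f g h => by
    rw [arrow_equiv_iff] at *
    have h1 := compProd_posterior_eq_map_swap (κ := g.kernel) (μ := X.measure)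
    have h2 := compProd_posterior_eq_map_swap (κ := f.kernel) (μ := X.measure)
    rw [← Measure.compProd_congr h, ← h2] at h1
    have h3 := ae_eq_posterior_of_compProd_eq (κ := f.kernel) (μ := X.measure)
      (η := g.kernel†X.measure) (by
        rw [f.comp_measure, g.comp_measure] at h1
        rw [f.comp_measure, h1, ← h2, f.comp_measure])
    rw [f.comp_measure] at h3
    exact h3.symm

theorem posterior_comp_of_eq {X Y Z : Krn.{u}} (g : Kernel Z Y) (f : Kernel Y X)
    [IsMarkovKernel g] [IsMarkovKernel f] {μ : Measure Z} {ν : Measure Y} [IsFiniteMeasure μ]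
    [IsFiniteMeasure ν] (h : g ∘ₘ μ = ν) : (f ∘ₖ g)†μ =ᵐ[f ∘ₘ ν] g†μ ∘ₖ f†ν := by
  subst h
  exact posterior_comp

/-- The contravariant functor `(-)†` given by Bayesian inversion. -/
noncomputable def dagger : Krn.{u}ᵒᵖ ⥤ Krn.{u} where
  obj X := X.unop
  map f := daggerHom f.unop
  map_id X := Quotient.sound (arrow_equiv_iff.2 (posterior_id X.unop.measure))
  map_comp := by
    intro X Y Z f g
    obtain ⟨X⟩ := X
    obtain ⟨Y⟩ := Y
    obtain ⟨Z⟩ := Z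
    obtain ⟨⟨f⟩⟩ := f
    obtain ⟨⟨g⟩⟩ := g
    have h := posterior_comp_of_eq g.kernel f.kernel g.comp_measure
    rw [f.comp_measure] at h
    exact Quotient.sound (arrow_equiv_iff.2 h)

end Krn

/-! ### The functors `L^p` -/

section Lp

variable {α β : Type u} [MeasurableSpace α] [MeasurableSpace β]

instance lpIsOrderedModule {μ : Measure α} {p : ℝ≥0∞} : IsOrderedModule ℝ (Lp ℝ p μ) :=
  IsOrderedModule.of_smul_nonneg fun c hc f hf => by
    rw [← Lp.coeFn_nonneg] at hf ⊢
    filter_upwards [hf, Lp.coeFn_smul c f] with x h1 h2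
    rw [h2]
    exact mul_nonneg hc h1

/-- Integrating an `L^p` function against a Markov kernel gives an `L^p` function. -/
theorem memLp_integral_kernel {κ : Kernel α β} [IsMarkovKernel κ] {μ : Measure α}
    [IsProbabilityMeasure μ] {p : ℝ≥0∞} (hp : 1 ≤ p) {φ : β → ℝ} (hφ : MemLp φ p (κ ∘ₘ μ)) :
    MemLp (fun x => ∫ y, φ y ∂κ x) p μ := by
  have hint : Integrable φ (κ ∘ₘ μ) := hφ.integrable hp
  have hmeas : AEStronglyMeasurable (fun x => ∫ y, φ y ∂κ x) μ := by
    refine ⟨fun x => ∫ y, hint.1.mk φ y ∂κ x, hint.1.stronglyMeasurable_mk.integral_kernel, ?_⟩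
    filter_upwards [Measure.ae_ae_of_ae_comp hint.1.ae_eq_mk] with x hx using integral_congr_ae hx
  rcases eq_or_ne p ∞ with rfl | htop
  · obtain ⟨C, hC⟩ : ∃ C : ℝ, ∀ᵐ y ∂(κ ∘ₘ μ), ‖φ y‖ ≤ C :=
      ⟨(eLpNormEssSup φ (κ ∘ₘ μ)).toReal, by
        have h2 : eLpNormEssSup φ (κ ∘ₘ μ) ≠ ∞ := by
          rw [← eLpNorm_exponent_top]; exact hφ.2.ne
        filter_upwards [ae_le_eLpNormEssSup (f := φ) (μ := κ ∘ₘ μ)] with y hy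
        rw [← toReal_enorm]
        exact ENNReal.toReal_mono h2 hy⟩
    refine memLp_top_of_bound hmeas C ?_
    filter_upwards [Measure.ae_ae_of_ae_comp hC] with x hx
    have := norm_integral_le_of_norm_le_const hx
    simpa using this
  · have hp0 : p ≠ 0 := (zero_lt_one.trans_le hp).ne'
    have hpr : 0 < p.toReal := ENNReal.toReal_pos hp0 htop
    refine ⟨hmeas, ?_⟩
    rw [eLpNorm_lt_top_iff_lintegral_rpow_enorm_lt_top hp0 htop]
    have h1 := lintegral_rpow_enorm_lt_top_of_eLpNorm_lt_top hp0 htop hφ.2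
    rw [Measure.lintegral_bind κ.measurable.aemeasurable (hφ.1.enorm.pow_const _)] at h1
    refine lt_of_le_of_lt (lintegral_mono_ae ?_) h1
    filter_upwards [Measure.ae_ae_of_ae_comp hint.1.ae_eq_mk] with x hx
    have hm : AEStronglyMeasurable φ (κ x) := ⟨_, hint.1.stronglyMeasurable_mk, hx⟩
    calc ‖∫ y, φ y ∂κ x‖ₑ ^ p.toReal ≤ (eLpNorm φ p (κ x)) ^ p.toReal := by
          gcongr
          refine (enorm_integral_le_lintegral_enorm _).trans ?_
          rw [← eLpNorm_one_eq_lintegral_enorm]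
          exact eLpNorm_le_eLpNorm_of_exponent_le hp hm
      _ = ∫⁻ y, ‖φ y‖ₑ ^ p.toReal ∂κ x := by
          rw [eLpNorm_eq_lintegral_rpow_enorm_toReal hp0 htop, ← ENNReal.rpow_mul,
            one_div_mul_cancel hpr.ne', ENNReal.rpow_one]

variable {μ : Measure α} {ν : Measure β} {p q : ℝ≥0∞}

theorem lp_ae_monotone {v : ℕ → Lp ℝ p μ} (hv : Monotone v) :
    ∀ᵐ x ∂μ, Monotone fun n => v n x := by
  have : ∀ᵐ x ∂μ, ∀ n, v n x ≤ v (n + 1) x :=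
    ae_all_iff.2 fun n => (Lp.coeFn_le _ _).2 (hv (Nat.le_succ n))
  filter_upwards [this] with x hx using monotone_nat_of_le_succ hx

/-- Suprema of increasing sequences in `L^p` are almost everywhere limits. -/
theorem lp_tendsto_of_isLUB {v : ℕ → Lp ℝ p μ} {f : Lp ℝ p μ} (hv : Monotone v)
    (hf : IsLUB (Set.range v) f) : ∀ᵐ x ∂μ, Tendsto (fun n => v n x) atTop (𝓝 (f x)) := by
  have hle : ∀ᵐ x ∂μ, ∀ n, v n x ≤ f x :=
    ae_all_iff.2 fun n => (Lp.coeFn_le _ _).2 (hf.1 ⟨n, rfl⟩)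
  have hmono := lp_ae_monotone hv
  have hlim : ∀ᵐ x ∂μ, Tendsto (fun n => v n x) atTop (𝓝 (⨆ n, v n x)) := by
    filter_upwards [hle, hmono] with x h1 h2
    exact tendsto_atTop_ciSup h2 ⟨f x, by rintro _ ⟨n, rfl⟩; exact h1 n⟩
  have hm : AEStronglyMeasurable (fun x => ⨆ n, v n x) μ :=
    aestronglyMeasurable_of_tendsto_ae atTop (fun n => Lp.aestronglyMeasurable (v n)) hlim
  have hL : MemLp (fun x => ⨆ n, v n x) p μ := by
    refine MemLp.mono' ((Lp.memLp (v 0)).norm.add (Lp.memLp f).norm) hm ?_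
    filter_upwards [hle, hmono, hlim] with x h1 h2 h3
    have h4 : v 0 x ≤ ⨆ n, v n x := h2.ge_of_tendsto h3 0
    have h5 : (⨆ n, v n x) ≤ f x := le_of_tendsto' h3 h1
    simp only [Pi.add_apply, Real.norm_eq_abs]
    rw [abs_le]
    constructor <;> linarith [neg_abs_le (v 0 x), le_abs_self (f x), abs_nonneg (v 0 x),
      abs_nonneg (f x)]
  have hfG : f ≤ hL.toLp _ := hf.2 (by
    rintro _ ⟨n, rfl⟩
    rw [← Lp.coeFn_le]
    filter_upwards [hmono, hlim, hL.coeFn_toLp] with x h2 h3 h4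
    rw [h4]
    exact h2.ge_of_tendsto h3 n)
  filter_upwards [(Lp.coeFn_le _ _).2 hfG, hL.coeFn_toLp, hle, hlim] with x h1 h2 h3 h4
  rw [h2] at h1
  rwa [le_antisymm h1 (le_of_tendsto' h4 h3)]

theorem lp_isLUB_of_tendsto {v : ℕ → Lp ℝ p μ} {f : Lp ℝ p μ} (hv : Monotone v)
    (hf : ∀ᵐ x ∂μ, Tendsto (fun n => v n x) atTop (𝓝 (f x))) : IsLUB (Set.range v) f := by
  constructor
  · rintro _ ⟨n, rfl⟩
    rw [← Lp.coeFn_le]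
    filter_upwards [hf, lp_ae_monotone hv] with x h1 h2 using h2.ge_of_tendsto h1 n
  · intro g hg
    rw [← Lp.coeFn_le]
    have hle : ∀ᵐ x ∂μ, ∀ n, v n x ≤ g x :=
      ae_all_iff.2 fun n => (Lp.coeFn_le _ _).2 (hg ⟨n, rfl⟩)
    filter_upwards [hf, hle] with x h1 h2 using le_of_tendsto' h1 h2

end Lp

section LpFunctor

variable (p q : ℝ≥0∞) [Fact (1 ≤ p)] [Fact (1 ≤ q)]

/-- `L^p(X, μ)` as a Banach lattice. -/
noncomputable def lpObj (X : Krn.{u}) : BanLat.{u} := ⟨Lp ℝ p X.measure⟩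

variable {X Y Z : Krn.{u}}

theorem memLp_arrow (f : Krn.Arrow X Y) (φ : Lp ℝ p Y.measure) :
    MemLp (fun x => ∫ y, φ y ∂f.kernel x) p X.measure :=
  memLp_integral_kernel Fact.out (by rw [f.comp_measure]; exact Lp.memLp φ)

/-- The predicate transformer `φ ↦ (x ↦ ∫ φ d f(x))` on `L^p`. -/
noncomputable def lpMapFun (f : Krn.Arrow X Y) (φ : Lp ℝ p Y.measure) : Lp ℝ p X.measure :=
  (memLp_arrow p f φ).toLp _

theorem lpMapFun_coe (f : Krn.Arrow X Y) (φ : Lp ℝ p Y.measure) :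
    lpMapFun p f φ =ᵐ[X.measure] fun x => ∫ y, φ y ∂f.kernel x :=
  (memLp_arrow p f φ).coeFn_toLp

theorem Krn.Arrow.ae_ae (f : Krn.Arrow X Y) {P : Y → Prop} (h : ∀ᵐ y ∂Y.measure, P y) :
    ∀ᵐ x ∂X.measure, ∀ᵐ y ∂f.kernel x, P y := by
  rw [← f.comp_measure] at h
  exact Measure.ae_ae_of_ae_comp h

theorem Krn.Arrow.ae_integrable (f : Krn.Arrow X Y) {φ : Y → ℝ} (h : Integrable φ Y.measure) :
    ∀ᵐ x ∂X.measure, Integrable φ (f.kernel x) := by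
  rw [← f.comp_measure] at h
  exact ((Measure.integrable_comp_iff h.1).1 h).1

theorem lp_integrable (φ : Lp ℝ p Y.measure) : Integrable φ Y.measure :=
  (Lp.memLp φ).integrable Fact.out

/-- The predicate transformer of an arrow as a linear map. -/
noncomputable def lpMapLin (f : Krn.Arrow X Y) : Lp ℝ p Y.measure →ₗ[ℝ] Lp ℝ p X.measure where
  toFun := lpMapFun p f
  map_add' φ ψ := by
    apply Lp.ext
    refine (lpMapFun_coe p f _).trans (.trans ?_ (Lp.coeFn_add _ _).symm)
    filter_upwards [f.ae_ae (Lp.coeFn_add φ ψ), lpMapFun_coe p f φ, lpMapFun_coe p f ψ,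
      f.ae_integrable (lp_integrable p φ), f.ae_integrable (lp_integrable p ψ)]
      with x h1 h2 h3 h4 h5
    rw [Pi.add_apply, h2, h3, integral_congr_ae h1]
    exact integral_add h4 h5
  map_smul' c φ := by
    apply Lp.ext
    refine (lpMapFun_coe p f _).trans (.trans ?_ (Lp.coeFn_smul _ _).symm)
    filter_upwards [f.ae_ae (Lp.coeFn_smul c φ), lpMapFun_coe p f φ] with x h1 h2
    rw [Pi.smul_apply, RingHom.id_apply, h2, integral_congr_ae h1]
    exact integral_const_mul c _

/-- The predicate transformer of an arrow as a morphism of Banach lattices. -/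
noncomputable def lpMap (f : Krn.Arrow X Y) : lpObj p Y ⟶ lpObj p X where
  toLinearMap := lpMapLin p f
  pos φ hφ := by
    change 0 ≤ lpMapFun p f φ
    rw [← Lp.coeFn_nonneg]
    filter_upwards [f.ae_ae ((Lp.coeFn_nonneg _).2 hφ), lpMapFun_coe p f φ] with x h1 h2
    rw [h2]
    exact integral_nonneg_of_ae h1
  map_isLUB v φ hv hφ := by
    have hm : Monotone fun n => lpMapFun p f (v n) := by
      intro m n hmn
      change lpMapFun p f (v m) ≤ lpMapFun p f (v n)
      rw [← Lp.coeFn_le]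
      filter_upwards [f.ae_ae ((Lp.coeFn_le _ _).2 (hv hmn)), lpMapFun_coe p f (v m),
        lpMapFun_coe p f (v n), f.ae_integrable (lp_integrable p (v m)),
        f.ae_integrable (lp_integrable p (v n))] with x h1 h2 h3 h4 h5
      rw [h2, h3]
      exact integral_mono_ae h4 h5 h1
    refine lp_isLUB_of_tendsto hm ?_
    filter_upwards [f.ae_ae (lp_tendsto_of_isLUB hv hφ), f.ae_ae (lp_ae_monotone hv),
      ae_all_iff.2 fun n => f.ae_integrable (lp_integrable p (v n)),
      f.ae_integrable (lp_integrable p φ), ae_all_iff.2 fun n => lpMapFun_coe p f (v n),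
      lpMapFun_coe p f φ] with x h1 h2 h3 h4 h5 h6
    have key := integral_tendsto_of_tendsto_of_monotone h3 h4 h2 h1
    rw [← h6] at key
    exact key.congr fun n => (h5 n).symm

/-- The contravariant functor `L^p` (predicate transformers), for `1 ≤ p ≤ ∞`. -/
noncomputable def LpOp : Krn.{u}ᵒᵖ ⥤ BanLat.{u} where
  obj X := lpObj p X.unop
  map {X Y} f := Quotient.lift (lpMap p) (fun f g h => by
    refine BanLat.hom_ext fun φ => Lp.ext ?_
    refine (lpMapFun_coe p f φ).trans (.trans ?_ (lpMapFun_coe p g φ).symm)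
    filter_upwards [Krn.arrow_equiv_iff.1 h] with x hx
    rw [hx]) f.unop
  map_id X := by
    refine BanLat.hom_ext fun (φ : Lp ℝ p X.unop.measure) => Lp.ext ?_
    refine (lpMapFun_coe p (Krn.Arrow.id X.unop) φ).trans ?_
    have h := (Lp.stronglyMeasurable φ)
    filter_upwards with x
    change ∫ y, φ y ∂(Kernel.id x) = _
    rw [Kernel.id_apply, integral_dirac' _ _ h]
    rfl
  map_comp := by
    intro Z Y X g f
    obtain ⟨X⟩ := X
    obtain ⟨Y⟩ := Y
    obtain ⟨Z⟩ := Z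
    obtain ⟨⟨f⟩⟩ := f
    obtain ⟨⟨g⟩⟩ := g
    refine BanLat.hom_ext fun φ => Lp.ext ?_
    refine (lpMapFun_coe p (f.comp g) φ).trans
      (.trans ?_ (lpMapFun_coe p f (lpMapFun p g φ)).symm)
    filter_upwards [f.ae_ae (lpMapFun_coe p g φ),
      (f.comp g).ae_integrable (lp_integrable p φ)] with x h1 h2
    rw [integral_congr_ae h1]
    exact Kernel.integral_comp h2

/-- The covariant functor `L^p`: the contravariant one precomposed with Bayesian inversion. -/
noncomputable def LpCov : Krn.{u} ⥤ BanLat.{u} := Krn.dagger.rightOp ⋙ LpOp p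

/-- The functor `(-)^σ ∘ L^p`. -/
noncomputable def LpDual : Krn.{u} ⥤ BanLat.{u} := (LpOp p).rightOp ⋙ sigmaDual

variable {p q}

/-- The inclusion `L^q(X, μ) ⊆ L^p(X, μ)` for `p ≤ q`, as a linear map. -/
noncomputable def lpInclLin (h : p ≤ q) (X : Krn.{u}) :
    Lp ℝ q X.measure →ₗ[ℝ] Lp ℝ p X.measure where
  toFun φ := ((Lp.memLp φ).mono_exponent h).toLp φ
  map_add' φ ψ := by
    apply Lp.ext
    refine (MemLp.coeFn_toLp _).trans (.trans ?_ (Lp.coeFn_add _ _).symm)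
    filter_upwards [Lp.coeFn_add φ ψ, ((Lp.memLp φ).mono_exponent h).coeFn_toLp,
      ((Lp.memLp ψ).mono_exponent h).coeFn_toLp] with x h1 h2 h3
    rw [Pi.add_apply, h2, h3]
    exact h1
  map_smul' c φ := by
    apply Lp.ext
    refine (MemLp.coeFn_toLp _).trans (.trans ?_ (Lp.coeFn_smul _ _).symm)
    filter_upwards [Lp.coeFn_smul c φ, ((Lp.memLp φ).mono_exponent h).coeFn_toLp] with x h1 h2
    rw [Pi.smul_apply, RingHom.id_apply, h2]
    exact h1

theorem lpInclLin_coe (h : p ≤ q) (X : Krn.{u}) (φ : Lp ℝ q X.measure) :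
    lpInclLin h X φ =ᵐ[X.measure] φ :=
  ((Lp.memLp φ).mono_exponent h).coeFn_toLp

/-- The inclusion `L^q(X, μ) ⊆ L^p(X, μ)` for `p ≤ q`, as a morphism of Banach lattices. -/
noncomputable def lpInclApp (h : p ≤ q) (X : Krn.{u}) : lpObj q X ⟶ lpObj p X where
  toLinearMap := lpInclLin h X
  pos φ hφ := by
    change 0 ≤ lpInclLin h X φ
    rw [← Lp.coeFn_nonneg]
    filter_upwards [(Lp.coeFn_nonneg _).2 hφ, lpInclLin_coe h X φ] with x h1 h2
    rw [h2]
    exact h1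
  map_isLUB v φ hv hφ := by
    have hc := fun n => lpInclLin_coe h X (v n)
    refine lp_isLUB_of_tendsto (p := p) (fun m n hmn => ?_) ?_
    · change lpInclLin h X (v m) ≤ lpInclLin h X (v n)
      rw [← Lp.coeFn_le]
      filter_upwards [hc m, hc n, (Lp.coeFn_le _ _).2 (hv hmn)] with x h1 h2 h3
      rw [h1, h2]
      exact h3
    · filter_upwards [ae_all_iff.2 hc, lpInclLin_coe h X φ,
        lp_tendsto_of_isLUB hv hφ] with x h1 h2 h3
      rw [← h2] at h3
      exact h3.congr fun n => (h1 n).symm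

/-- The inclusions `L^q ⊆ L^p`, `p ≤ q`, as a transformation of contravariant functors. -/
noncomputable def lpIncl (h : p ≤ q) : LpOp.{u} q ⟶ LpOp.{u} p where
  app X := lpInclApp h X.unop
  naturality := by
    intro Y X f
    obtain ⟨X⟩ := X
    obtain ⟨Y⟩ := Y
    obtain ⟨⟨f⟩⟩ := f
    refine BanLat.hom_ext fun φ => Lp.ext ?_
    refine (lpInclLin_coe h X (lpMapFun q f φ)).trans (.trans (lpMapFun_coe q f φ)
      (.trans ?_ (lpMapFun_coe p f (lpInclLin h Y φ)).symm))
    filter_upwards [f.ae_ae (lpInclLin_coe h Y φ)] with x hx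
    exact (integral_congr_ae hx).symm

/-- The inclusions `L^q ⊆ L^p`, `p ≤ q`, as a transformation of covariant functors. -/
noncomputable def lpCovIncl (h : p ≤ q) : LpCov.{u} q ⟶ LpCov.{u} p :=
  Functor.whiskerLeft Krn.dagger.rightOp (lpIncl h)

/-- Restriction of functionals `(L^p)^σ → (L^q)^σ` along the inclusions `L^q ⊆ L^p`, `p ≤ q`. -/
noncomputable def lpDualRestrict (h : p ≤ q) : LpDual.{u} p ⟶ LpDual.{u} q :=
  Functor.whiskerRight (NatTrans.rightOp (lpIncl h)) sigmaDual

end LpFunctor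

/-! ### The functor of absolutely continuous measures -/

section Band

variable {α : Type u} [MeasurableSpace α]

/-- The finite signed measures absolutely continuous with respect to `μ`. -/
def acSubmodule (μ : Measure α) : Submodule ℝ (SignedMeasure α) where
  carrier := {ρ | ρ ≪ᵥ μ.toENNRealVectorMeasure}
  zero_mem' := fun _ _ => rfl
  add_mem' := fun h1 h2 => h1.add h2
  smul_mem' := fun _ _ h => h.smul

/-- The band `B_μ` generated by `μ` among the finite signed measures: the signed measures absolutely
continuous with respect to `μ`, with setwise order and total variation norm. -/
def MeasBand (μ : Measure α) : Type u := acSubmodule μ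

variable {μ : Measure α}

instance : AddCommGroup (MeasBand μ) := inferInstanceAs (AddCommGroup (acSubmodule μ))

instance : Module ℝ (MeasBand μ) := inferInstanceAs (Module ℝ (acSubmodule μ))

/-- The underlying signed measure. -/
def MeasBand.val (ρ : MeasBand μ) : SignedMeasure α := Subtype.val ρ

instance : CoeFun (MeasBand μ) (fun _ => Set α → ℝ) := ⟨fun ρ => ρ.val⟩

namespace MeasBand

theorem ac (ρ : MeasBand μ) : ρ.val ≪ᵥ μ.toENNRealVectorMeasure := Subtype.property ρ

theorem ext {ρ σ : MeasBand μ} (h : ∀ B, MeasurableSet B → ρ B = σ B) : ρ = σ :=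
  Subtype.ext (VectorMeasure.ext h)

theorem val_add (ρ σ : MeasBand μ) : (ρ + σ).val = ρ.val + σ.val := rfl
theorem val_smul (c : ℝ) (ρ : MeasBand μ) : (c • ρ).val = c • ρ.val := rfl
theorem val_sub (ρ σ : MeasBand μ) : (ρ - σ).val = ρ.val - σ.val := rfl

instance : PartialOrder (MeasBand μ) where
  le ρ σ := ∀ B, MeasurableSet B → ρ B ≤ σ B
  le_refl _ _ _ := le_rfl
  le_trans _ _ _ h1 h2 B hB := (h1 B hB).trans (h2 B hB)
  le_antisymm _ _ h1 h2 := ext fun B hB => le_antisymm (h1 B hB) (h2 B hB)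

instance : IsOrderedAddMonoid (MeasBand μ) where
  add_le_add_left ρ σ h τ B hB := by
    rw [val_add, val_add, _root_.add_apply, _root_.add_apply]
    linarith [h B hB]

instance : IsOrderedModule ℝ (MeasBand μ) :=
  IsOrderedModule.of_smul_nonneg fun c hc ρ hρ B hB => by
    rw [val_smul, _root_.smul_apply]
    exact mul_nonneg hc (hρ B hB)

theorem variation_ne_top (ρ : SignedMeasure α) : ρ.variation Set.univ ≠ ∞ := by
  rw [← SignedMeasure.totalVariation_eq_variation]
  exact measure_ne_top _ _

/-- The total variation norm. -/
noncomputable instance : NormedAddCommGroup (MeasBand μ) :=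
  AddGroupNorm.toNormedAddCommGroup
    { toFun := fun ρ => (ρ.val.variation Set.univ).toReal
      map_zero' := by
        change ((0 : SignedMeasure α).variation Set.univ).toReal = 0
        simp
      add_le' := fun ρ σ => by
        rw [← ENNReal.toReal_add (variation_ne_top _) (variation_ne_top _)]
        refine ENNReal.toReal_mono
          (ENNReal.add_ne_top.2 ⟨variation_ne_top _, variation_ne_top _⟩) ?_
        exact VectorMeasure.variation_add_le (μ := ρ.val) (ν := σ.val) Set.univ
      neg' := fun ρ => by
        change ((-ρ.val).variation Set.univ).toReal = _
        rw [VectorMeasure.variation_neg]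
      eq_zero_of_map_eq_zero' := fun ρ h => by
        rw [ENNReal.toReal_eq_zero_iff, or_iff_left (variation_ne_top _),
          Measure.measure_univ_eq_zero, VectorMeasure.variation_eq_zero] at h
        exact Subtype.ext h }

theorem norm_def (ρ : MeasBand μ) : ‖ρ‖ = (ρ.val.variation Set.univ).toReal := rfl

noncomputable instance : NormedSpace ℝ (MeasBand μ) where
  norm_smul_le c ρ := by
    rw [norm_def, norm_def, val_smul, VectorMeasure.variation_smul]
    simp

variable [IsFiniteMeasure μ]

/-- The indefinite integral of an integrable function. -/
noncomputable def ofL1 (μ : Measure α) : Lp ℝ 1 μ →ₗ[ℝ] MeasBand μ where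
  toFun φ := ⟨μ.withDensityᵥ φ, Measure.withDensityᵥ_absolutelyContinuous μ φ⟩
  map_add' φ ψ := Subtype.ext <| by
    change μ.withDensityᵥ _ = μ.withDensityᵥ _ + μ.withDensityᵥ _
    rw [WithDensityᵥEq.congr_ae (Lp.coeFn_add φ ψ)]
    exact withDensityᵥ_add (L1.integrable_coeFn φ) (L1.integrable_coeFn ψ)
  map_smul' c φ := Subtype.ext <| by
    change μ.withDensityᵥ _ = c • μ.withDensityᵥ _
    rw [WithDensityᵥEq.congr_ae (Lp.coeFn_smul c φ)]
    exact withDensityᵥ_smul φ c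

theorem ofL1_val (φ : Lp ℝ 1 μ) : (ofL1 μ φ).val = μ.withDensityᵥ φ := rfl

theorem ofL1_apply (φ : Lp ℝ 1 μ) {B : Set α} (hB : MeasurableSet B) :
    ofL1 μ φ B = ∫ x in B, φ x ∂μ := withDensityᵥ_apply (L1.integrable_coeFn φ) hB

theorem ofL1_le_iff {φ ψ : Lp ℝ 1 μ} : ofL1 μ φ ≤ ofL1 μ ψ ↔ φ ≤ ψ := by
  rw [← Lp.coeFn_le]
  constructor
  · intro h
    refine ae_le_of_forall_setIntegral_le (L1.integrable_coeFn φ) (L1.integrable_coeFn ψ) ?_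
    intro s hs _
    have := h s hs
    rwa [ofL1_apply _ hs, ofL1_apply _ hs] at this
  · intro h B hB
    rw [ofL1_apply _ hB, ofL1_apply _ hB]
    exact setIntegral_mono_ae (L1.integrable_coeFn φ).integrableOn
      (L1.integrable_coeFn ψ).integrableOn h

theorem norm_ofL1 (φ : Lp ℝ 1 μ) : ‖ofL1 μ φ‖ = ‖φ‖ := by
  have hm : Measurable φ := (Lp.stronglyMeasurable φ).measurable
  have hz : (0 : SignedMeasure α) ⟂ᵥ μ.toENNRealVectorMeasure :=
    VectorMeasure.MutuallySingular.zero_left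
  have hj := SignedMeasure.toJordanDecomposition_eq_of_eq_add_withDensity hm
    (L1.integrable_coeFn φ) hz (s := μ.withDensityᵥ φ) (by rw [zero_add])
  rw [norm_def, ofL1_val, ← SignedMeasure.totalVariation_eq_variation,
    SignedMeasure.totalVariation, hj, Lp.norm_def, eLpNorm_one_eq_lintegral_enorm]
  congr 1
  simp only [SignedMeasure.toJordanDecomposition_zero, JordanDecomposition.zero_posPart,
    JordanDecomposition.zero_negPart, zero_add, Measure.add_apply,
    withDensity_apply _ MeasurableSet.univ, Measure.restrict_univ]
  rw [← lintegral_add_left hm.ennreal_ofReal]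
  refine lintegral_congr fun x => ?_
  rw [← ofReal_norm, Real.norm_eq_abs]
  rcases le_total 0 (φ x) with h | h
  · rw [abs_of_nonneg h, ENNReal.ofReal_of_nonpos (neg_nonpos.2 h), add_zero]
  · rw [abs_of_nonpos h, ENNReal.ofReal_of_nonpos h, zero_add]

/-- The Radon–Nikodym isometry. -/
noncomputable def l1Equiv (μ : Measure α) [IsFiniteMeasure μ] : Lp ℝ 1 μ ≃ₗ[ℝ] MeasBand μ :=
  LinearEquiv.ofBijective (ofL1 μ)
    ⟨fun φ ψ h => le_antisymm (ofL1_le_iff.1 h.le) (ofL1_le_iff.1 h.ge), fun ρ =>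
      ⟨(SignedMeasure.integrable_rnDeriv ρ.val μ).toL1 _, Subtype.ext (by
        change μ.withDensityᵥ _ = ρ.val
        rw [WithDensityᵥEq.congr_ae (Integrable.coeFn_toL1 _)]
        exact SignedMeasure.withDensityᵥ_rnDeriv_eq ρ.val μ ρ.ac)⟩⟩

theorem l1Equiv_symm_le_iff {ρ σ : MeasBand μ} :
    (l1Equiv μ).symm ρ ≤ (l1Equiv μ).symm σ ↔ ρ ≤ σ := by
  rw [← ofL1_le_iff]
  change l1Equiv μ _ ≤ l1Equiv μ _ ↔ _
  rw [LinearEquiv.apply_symm_apply, LinearEquiv.apply_symm_apply]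

theorem norm_l1Equiv (φ : Lp ℝ 1 μ) : ‖l1Equiv μ φ‖ = ‖φ‖ := norm_ofL1 φ

/-- The lattice operations of the setwise order, computed through densities. -/
noncomputable instance : Lattice (MeasBand μ) where
  sup ρ σ := l1Equiv μ ((l1Equiv μ).symm ρ ⊔ (l1Equiv μ).symm σ)
  le_sup_left ρ σ := by simp [← l1Equiv_symm_le_iff]
  le_sup_right ρ σ := by simp [← l1Equiv_symm_le_iff]
  sup_le ρ σ τ h1 h2 := by
    rw [← l1Equiv_symm_le_iff] at *
    simpa using ⟨h1, h2⟩
  inf ρ σ := l1Equiv μ ((l1Equiv μ).symm ρ ⊓ (l1Equiv μ).symm σ)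
  inf_le_left ρ σ := by simp [← l1Equiv_symm_le_iff]
  inf_le_right ρ σ := by simp [← l1Equiv_symm_le_iff]
  le_inf ρ σ τ h1 h2 := by
    rw [← l1Equiv_symm_le_iff] at *
    simpa using ⟨h1, h2⟩

instance : HasSolidNorm (MeasBand μ) where
  solid ρ σ h := by
    have habs : ∀ τ : MeasBand μ, (l1Equiv μ).symm |τ| = |(l1Equiv μ).symm τ| := fun τ => by
      change (l1Equiv μ).symm (l1Equiv μ ((l1Equiv μ).symm τ ⊔ (l1Equiv μ).symm (-τ))) = _
      rw [LinearEquiv.symm_apply_apply, map_neg]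
      rfl
    rw [← l1Equiv_symm_le_iff, habs, habs] at h
    have := norm_le_norm_of_abs_le_abs h
    rwa [← norm_l1Equiv, ← norm_l1Equiv, LinearEquiv.apply_symm_apply,
      LinearEquiv.apply_symm_apply] at this

instance : CompleteSpace (MeasBand μ) :=
  let e : Lp ℝ 1 μ ≃ₗᵢ[ℝ] MeasBand μ := ⟨l1Equiv μ, norm_l1Equiv⟩
  e.symm.toIsometryEquiv.completeSpace

/-- Increasing sequences converge to their supremum in total mass. -/
theorem tendsto_univ {v : ℕ → MeasBand μ} {ρ : MeasBand μ} (hv : Monotone v)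
    (hρ : IsLUB (Set.range v) ρ) :
    Tendsto (fun n => v n Set.univ) atTop (𝓝 (ρ Set.univ)) := by
  have h1 : Monotone fun n => (l1Equiv μ).symm (v n) := fun m n hmn =>
    l1Equiv_symm_le_iff.2 (hv hmn)
  have h2 : IsLUB (Set.range fun n => (l1Equiv μ).symm (v n)) ((l1Equiv μ).symm ρ) := by
    constructor
    · rintro _ ⟨n, rfl⟩
      exact l1Equiv_symm_le_iff.2 (hρ.1 ⟨n, rfl⟩)
    · intro ψ hψ
      rw [← (l1Equiv μ).symm_apply_apply ψ, l1Equiv_symm_le_iff]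
      refine hρ.2 ?_
      rintro _ ⟨n, rfl⟩
      rw [← l1Equiv_symm_le_iff, LinearEquiv.symm_apply_apply]
      exact hψ ⟨n, rfl⟩
  have hval : ∀ σ : MeasBand μ, σ Set.univ = ∫ x, (l1Equiv μ).symm σ x ∂μ := fun σ => by
    have := ofL1_apply ((l1Equiv μ).symm σ) MeasurableSet.univ
    rw [Measure.restrict_univ] at this
    rw [← this]
    change _ = l1Equiv μ ((l1Equiv μ).symm σ) Set.univ
    rw [LinearEquiv.apply_symm_apply]
  simp only [hval]
  exact integral_tendsto_of_tendsto_of_monotone (fun n => L1.integrable_coeFn _)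
    (L1.integrable_coeFn _) (lp_ae_monotone h1) (lp_tendsto_of_isLUB h1 h2)

end MeasBand

end Band

section KernelAction

variable {α β γ : Type u} [MeasurableSpace α] [MeasurableSpace β] [MeasurableSpace γ]

/-- The action of a Markov kernel `κ` on a finite signed measure `ρ`, that is
`B ↦ ∫ κ x B dρ`, computed through the Jordan decomposition of `ρ`. -/
noncomputable def kernelAct (κ : Kernel α β) [IsMarkovKernel κ] (ρ : SignedMeasure α) :
    SignedMeasure β :=
  (κ ∘ₘ ρ.toJordanDecomposition.posPart).toSignedMeasure -
    (κ ∘ₘ ρ.toJordanDecomposition.negPart).toSignedMeasure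

theorem toSignedMeasure_congr {m n : Measure α} [IsFiniteMeasure m] [IsFiniteMeasure n]
    (h : m = n) : m.toSignedMeasure = n.toSignedMeasure := by subst h; rfl

theorem kernelAct_sub (κ : Kernel α β) [IsMarkovKernel κ] (m n : Measure α) [IsFiniteMeasure m]
    [IsFiniteMeasure n] : kernelAct κ (m.toSignedMeasure - n.toSignedMeasure) =
      (κ ∘ₘ m).toSignedMeasure - (κ ∘ₘ n).toSignedMeasure := by
  set j := (m.toSignedMeasure - n.toSignedMeasure).toJordanDecomposition with hj
  have h : j.posPart.toSignedMeasure - j.negPart.toSignedMeasure =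
      m.toSignedMeasure - n.toSignedMeasure :=
    SignedMeasure.toSignedMeasure_toJordanDecomposition _
  have h2 : j.posPart + n = m + j.negPart := by
    rw [← Measure.toSignedMeasure_eq_toSignedMeasure_iff, Measure.toSignedMeasure_add,
      Measure.toSignedMeasure_add]
    exact sub_eq_sub_iff_add_eq_add.1 h
  have h3 : κ ∘ₘ j.posPart + κ ∘ₘ n = κ ∘ₘ m + κ ∘ₘ j.negPart := by
    rw [← Measure.comp_add, ← Measure.comp_add, h2]
  change (κ ∘ₘ j.posPart).toSignedMeasure - (κ ∘ₘ j.negPart).toSignedMeasure = _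
  rw [sub_eq_sub_iff_add_eq_add, ← Measure.toSignedMeasure_add, ← Measure.toSignedMeasure_add]
  exact toSignedMeasure_congr h3

theorem exists_sub (ρ : SignedMeasure α) : ∃ (m n : Measure α) (_ : IsFiniteMeasure m)
    (_ : IsFiniteMeasure n), ρ = m.toSignedMeasure - n.toSignedMeasure :=
  ⟨_, _, ρ.toJordanDecomposition.posPart_finite, ρ.toJordanDecomposition.negPart_finite,
    (SignedMeasure.toSignedMeasure_toJordanDecomposition ρ).symm⟩

theorem kernelAct_add (κ : Kernel α β) [IsMarkovKernel κ] (ρ σ : SignedMeasure α) :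
    kernelAct κ (ρ + σ) = kernelAct κ ρ + kernelAct κ σ := by
  obtain ⟨m, n, _, _, rfl⟩ := exists_sub ρ
  obtain ⟨m', n', _, _, rfl⟩ := exists_sub σ
  have h : m.toSignedMeasure - n.toSignedMeasure + (m'.toSignedMeasure - n'.toSignedMeasure) =
      (m + m').toSignedMeasure - (n + n').toSignedMeasure := by
    rw [Measure.toSignedMeasure_add, Measure.toSignedMeasure_add]; abel
  rw [h, kernelAct_sub, kernelAct_sub, kernelAct_sub,
    toSignedMeasure_congr (Measure.comp_add (κ := κ) (μ := m) (ν := m')),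
    toSignedMeasure_congr (Measure.comp_add (κ := κ) (μ := n) (ν := n')),
    Measure.toSignedMeasure_add, Measure.toSignedMeasure_add]
  abel

theorem kernelAct_neg (κ : Kernel α β) [IsMarkovKernel κ] (ρ : SignedMeasure α) :
    kernelAct κ (-ρ) = -kernelAct κ ρ := by
  obtain ⟨m, n, _, _, rfl⟩ := exists_sub ρ
  rw [neg_sub, kernelAct_sub, kernelAct_sub, neg_sub]

theorem kernelAct_smul (κ : Kernel α β) [IsMarkovKernel κ] (c : ℝ) (ρ : SignedMeasure α) :
    kernelAct κ (c • ρ) = c • kernelAct κ ρ := by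
  have key : ∀ r : NNReal, kernelAct κ (r • ρ) = r • kernelAct κ ρ := by
    intro r
    obtain ⟨m, n, _, _, rfl⟩ := exists_sub ρ
    have hr : ∀ m : Measure α, κ ∘ₘ (r • m) = r • (κ ∘ₘ m) := fun m =>
      Measure.comp_smul (r : ℝ≥0∞)
    rw [smul_sub, ← Measure.toSignedMeasure_smul, ← Measure.toSignedMeasure_smul, kernelAct_sub,
      kernelAct_sub, smul_sub, ← Measure.toSignedMeasure_smul, ← Measure.toSignedMeasure_smul,
      toSignedMeasure_congr (hr m), toSignedMeasure_congr (hr n)]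
  rcases le_total 0 c with h | h
  · exact key ⟨c, h⟩
  · have h2 := key ⟨-c, neg_nonneg.2 h⟩
    change kernelAct κ ((-c) • ρ) = (-c) • kernelAct κ ρ at h2
    have e1 : (-c) • ρ = -(c • ρ) := by ext B hB; simp
    have e2 : (-c) • kernelAct κ ρ = -(c • kernelAct κ ρ) := by ext B hB; simp
    rwa [e1, e2, kernelAct_neg, neg_inj] at h2

theorem kernelAct_comp (κ : Kernel α β) [IsMarkovKernel κ] (η : Kernel β γ) [IsMarkovKernel η]
    (ρ : SignedMeasure α) : kernelAct (η ∘ₖ κ) ρ = kernelAct η (kernelAct κ ρ) := by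
  rw [kernelAct.eq_1 κ, kernelAct_sub, kernelAct.eq_1]
  rw [← toSignedMeasure_congr (Measure.comp_assoc (μ := ρ.toJordanDecomposition.posPart)
      (κ := κ) (η := η)),
    ← toSignedMeasure_congr (Measure.comp_assoc (μ := ρ.toJordanDecomposition.negPart)
      (κ := κ) (η := η))]

theorem kernelAct_id (ρ : SignedMeasure α) : kernelAct (Kernel.id : Kernel α α) ρ = ρ := by
  conv_rhs => rw [← SignedMeasure.toSignedMeasure_toJordanDecomposition ρ]
  rw [kernelAct, JordanDecomposition.toSignedMeasure]
  rw [toSignedMeasure_congr (Measure.id_comp (μ := ρ.toJordanDecomposition.posPart)),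
    toSignedMeasure_congr (Measure.id_comp (μ := ρ.toJordanDecomposition.negPart))]

theorem kernelAct_nonneg (κ : Kernel α β) [IsMarkovKernel κ] {ρ : SignedMeasure α} (h : 0 ≤ ρ)
    {B : Set β} (hB : MeasurableSet B) : 0 ≤ kernelAct κ ρ B := by
  have h' := (VectorMeasure.le_restrict_univ_iff_le 0 ρ).2 h
  have e : ρ = (ρ.toMeasureOfZeroLE Set.univ MeasurableSet.univ h').toSignedMeasure -
      (0 : Measure α).toSignedMeasure := by
    rw [SignedMeasure.toMeasureOfZeroLE_toSignedMeasure, Measure.toSignedMeasure_zero, sub_zero]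
  rw [e, kernelAct_sub, toSignedMeasure_congr (show κ ∘ₘ (0 : Measure α) = 0 by simp),
    Measure.toSignedMeasure_zero, sub_zero, Measure.toSignedMeasure_apply_measurable hB]
  exact measureReal_nonneg

theorem kernelAct_univ (κ : Kernel α β) [IsMarkovKernel κ] (ρ : SignedMeasure α) :
    kernelAct κ ρ Set.univ = ρ Set.univ := by
  obtain ⟨m, n, _, _, rfl⟩ := exists_sub ρ
  have h : ∀ m : Measure α, (κ ∘ₘ m) Set.univ = m Set.univ := fun m => by
    rw [Measure.bind_apply MeasurableSet.univ κ.measurable.aemeasurable]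
    simp
  rw [kernelAct_sub, _root_.sub_apply, _root_.sub_apply]
  simp only [Measure.toSignedMeasure_apply_measurable MeasurableSet.univ, measureReal_def, h]

theorem kernelAct_ac {κ κ' : Kernel α β} [IsMarkovKernel κ] [IsMarkovKernel κ'] {μ : Measure α}
    {ρ : SignedMeasure α} (h : ρ ≪ᵥ μ.toENNRealVectorMeasure) :
    kernelAct κ ρ ≪ᵥ (κ ∘ₘ μ).toENNRealVectorMeasure ∧
      (κ =ᵐ[μ] κ' → kernelAct κ ρ = kernelAct κ' ρ) := by
  rw [SignedMeasure.absolutelyContinuous_ennreal_iff,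
    show μ.toENNRealVectorMeasure.ennrealToMeasure = μ from VectorMeasure.equivMeasure.right_inv μ,
    SignedMeasure.totalVariation_absolutelyContinuous_iff] at h
  constructor
  · refine VectorMeasure.AbsolutelyContinuous.mk fun B hB hB0 => ?_
    rw [Measure.toENNRealVectorMeasure_apply_measurable hB] at hB0
    rw [kernelAct, _root_.sub_apply, Measure.toSignedMeasure_apply_measurable hB,
      Measure.toSignedMeasure_apply_measurable hB, measureReal_def, measureReal_def,
      (h.1.comp_right κ) hB0, (h.2.comp_right κ) hB0]
    simp
  · intro hk
    rw [kernelAct, kernelAct, toSignedMeasure_congr (Measure.comp_congr (h.1.ae_le hk)),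
      toSignedMeasure_congr (Measure.comp_congr (h.2.ae_le hk))]

end KernelAction

section MFunctor

/-- The band generated by the measure of `X`, as a Banach lattice. -/
noncomputable def bandObj (X : Krn.{u}) : BanLat.{u} := ⟨MeasBand X.measure⟩

variable {X Y : Krn.{u}}

/-- The state transformer `ρ ↦ (B ↦ ∫ f x B dρ)` as a linear map. -/
noncomputable def bandMapLin (f : Krn.Arrow X Y) :
    MeasBand X.measure →ₗ[ℝ] MeasBand Y.measure where
  toFun ρ := ⟨kernelAct f.kernel ρ.val, by
    have h := (kernelAct_ac (κ := f.kernel) (κ' := f.kernel) ρ.ac).1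
    rwa [f.comp_measure] at h⟩
  map_add' ρ σ := Subtype.ext (kernelAct_add f.kernel ρ.val σ.val)
  map_smul' c ρ := Subtype.ext (kernelAct_smul f.kernel c ρ.val)

theorem bandMapLin_val (f : Krn.Arrow X Y) (ρ : MeasBand X.measure) :
    (bandMapLin f ρ).val = kernelAct f.kernel ρ.val := rfl

theorem bandMapLin_nonneg (f : Krn.Arrow X Y) {ρ : MeasBand X.measure} (h : 0 ≤ ρ) :
    0 ≤ bandMapLin f ρ := fun _ hB => kernelAct_nonneg f.kernel (fun B hB => h B hB) hB

theorem bandMapLin_isLUB (f : Krn.Arrow X Y) {v : ℕ → MeasBand X.measure}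
    {ρ : MeasBand X.measure} (hv : Monotone v) (hρ : IsLUB (Set.range v) ρ) :
    IsLUB (Set.range fun n => bandMapLin f (v n)) (bandMapLin f ρ) := by
  have hle : ∀ n, bandMapLin f (v n) ≤ bandMapLin f ρ := fun n => by
    rw [← sub_nonneg, ← map_sub]
    exact bandMapLin_nonneg f (sub_nonneg.2 (hρ.1 ⟨n, rfl⟩))
  constructor
  · rintro _ ⟨n, rfl⟩
    exact hle n
  · intro τ hτ B hB
    have hU := (MeasBand.tendsto_univ hv hρ).const_sub (ρ Set.univ)
    rw [sub_self] at hU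
    have hlim : Tendsto (fun n => bandMapLin f ρ B - bandMapLin f (v n) B) atTop (𝓝 0) := by
      refine squeeze_zero (fun n => sub_nonneg.2 (hle n B hB)) (fun n => ?_) hU
      have h1 : 0 ≤ (bandMapLin f ρ Bᶜ - bandMapLin f (v n) Bᶜ) :=
        sub_nonneg.2 (hle n _ hB.compl)
      have h2 : ∀ σ : MeasBand X.measure,
          bandMapLin f σ B + bandMapLin f σ Bᶜ = σ Set.univ := fun σ => by
        rw [← VectorMeasure.of_union disjoint_compl_right hB hB.compl, Set.union_compl_self,
          bandMapLin_val, kernelAct_univ]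
      have h3 := h2 ρ
      have h4 := h2 (v n)
      linarith
    have hge : ∀ n, bandMapLin f ρ B - τ B ≤ bandMapLin f ρ B - bandMapLin f (v n) B := fun n => by
      have : bandMapLin f (v n) B ≤ τ B := hτ ⟨n, rfl⟩ B hB
      linarith
    exact sub_nonpos.1 (ge_of_tendsto' hlim hge)

/-- The state transformer as a morphism of Banach lattices. -/
noncomputable def bandMap (f : Krn.Arrow X Y) : bandObj X ⟶ bandObj Y where
  toLinearMap := bandMapLin f
  pos _ h := bandMapLin_nonneg f h
  map_isLUB _ _ hv hρ := bandMapLin_isLUB f hv hρ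

/-- The covariant functor `(X, μ) ↦ B_μ`, acting on morphisms by `ρ ↦ f ∘ ρ`. -/
noncomputable def BandFun : Krn.{u} ⥤ BanLat.{u} where
  obj X := bandObj X
  map {X Y} := Quotient.lift bandMap fun f g h => BanLat.hom_ext fun ρ =>
    Subtype.ext ((kernelAct_ac (MeasBand.ac ρ)).2 (Krn.arrow_equiv_iff.1 h))
  map_id X := BanLat.hom_ext fun ρ => Subtype.ext (kernelAct_id (MeasBand.val ρ))
  map_comp := by
    rintro X Y Z ⟨f⟩ ⟨g⟩
    exact BanLat.hom_ext fun ρ =>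
      Subtype.ext (kernelAct_comp f.kernel g.kernel (MeasBand.val ρ))

end MFunctor

end KrnBL

open KrnBL

/-! The point is that a `σ`-order continuous functional on `L^∞` is integration against an `L^1`
density. If `B n` are disjoint measurable sets, the indicators of their finite unions increase to
the indicator of the whole union, so order continuity makes `B ↦ F 1_B` countably additive
(`hasSum_indTop`). It vanishes on null sets because `1_B` is then the zero class. Radon–Nikodym
provides a density `g`, and the identity `F φ = ∫ φ g dμ` spreads from indicators to all of `L^∞` by
monotone approximation (`SigmaDual.apply_eq_integral`).

Naturality of `rr` follows. Transposing along `f` replaces `1_B` by `x ↦ f(x)(B)`, and `∫ f(x)(B)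
g(x) dμ` is the value at `B` of `f` acting on the measure `g μ` (`kernelAct_withDensity`).
Naturality of `rn` is the symmetry that defines the Bayesian inverse: `μ ⊗ f` and `ν ⊗ f†` are one
joint law up to a swap, and integrating `φ(x) 1_B(y)` in either order gives the two sides
(`bandMapLin_l1Equiv`).

For conjugate `p`, `q`, the truncations `min φ n` increase to `φ ≥ 0`, so a functional on `L^q` is
determined by bounded functions. The density `g` of its restriction satisfies `∫ φ g ≤ ‖F‖ ‖φ‖_q`
for bounded `φ`, and the converse of Hölder's inequality puts `g` in `L^p`
(`memLp_of_forall_integral_le`). The inclusion `L^p ⊆ L^1` is injective, natural and an order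
embedding, so linearity, order continuity, naturality and uniqueness of `η` are all inherited from
`L^1` (`existsUnique_lift`). -/

namespace KrnBL

/-! ### Order continuous functionals on `L^∞` as measures with density -/

section Functionals

variable {α : Type u} [MeasurableSpace α] {μ : Measure α} {p : ℝ≥0∞} [Fact (1 ≤ p)]

/-- `σ`-order continuous functionals on `L^p` preserve limits of increasing sequences. -/
theorem SigmaDual.tendsto_of_ae_tendsto (F : SigmaDual (Lp ℝ p μ)) {v : ℕ → Lp ℝ p μ}
    {f : Lp ℝ p μ} (hv : Monotone v) (hf : ∀ᵐ x ∂μ, Tendsto (fun n => v n x) atTop (𝓝 (f x))) :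
    Tendsto (fun n => F (v n)) atTop (𝓝 (F f)) := by
  have hlub := lp_isLUB_of_tendsto hv hf
  -- Order continuity of `F` is given for sequences decreasing to zero, so it is applied to `f - v
  -- n`. A lower bound `w` of these makes `f - w` an upper bound of the `v n`, whence `w ≤ 0`.
  have h := F.tendsto (fun n => f - v n) (fun m n hmn => sub_le_sub_left (hv hmn) f) (by
    constructor
    · rintro _ ⟨n, rfl⟩
      exact sub_nonneg.2 (hlub.1 ⟨n, rfl⟩)
    · intro w hw
      have : f ≤ f - w := hlub.2 (by
        rintro _ ⟨n, rfl⟩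
        exact le_sub_comm.1 (hw ⟨n, rfl⟩))
      simpa using this)
  have h2 := h.const_sub (F f)
  simpa only [map_sub, sub_sub_cancel, sub_zero] using h2

variable [IsFiniteMeasure μ]

variable (μ) in
/-- The indicator function of a measurable set as an element of `L^∞`. -/
noncomputable abbrev indTop {B : Set α}
    (hB : MeasurableSet B) : Lp ℝ ∞ μ :=
  indicatorConstLp ∞ hB (measure_ne_top μ B) (1 : ℝ)

theorem indTop_coe {B : Set α} (hB : MeasurableSet B) :
    indTop μ hB =ᵐ[μ] B.indicator fun _ => (1 : ℝ) := indicatorConstLp_coeFn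

theorem indTop_nonneg {B : Set α} (hB : MeasurableSet B) : 0 ≤ indTop μ hB := by
  rw [← Lp.coeFn_nonneg]
  filter_upwards [indTop_coe (μ := μ) hB] with x h
  rw [h]
  exact Set.indicator_nonneg (fun _ _ => zero_le_one) x

theorem sum_indTop {B : ℕ → Set α} (hB : ∀ n, MeasurableSet (B n))
    (hd : Pairwise (Function.onFun Disjoint B)) (s : Finset ℕ) :
    ∑ n ∈ s, indTop μ (hB n) = indTop μ (s.measurableSet_biUnion fun n _ => hB n) := by
  induction s using Finset.induction_on with
  | empty =>
    refine Lp.ext ?_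
    filter_upwards [indTop_coe (μ := μ) (Finset.measurableSet_biUnion (∅ : Finset ℕ)
      fun n _ => hB n), Lp.coeFn_zero ℝ ∞ μ] with x h1 h2
    rw [Finset.sum_empty, h1, h2]
    simp
  | insert a s ha ih =>
    rw [Finset.sum_insert ha, ih]
    refine Lp.ext ?_
    filter_upwards [indTop_coe (μ := μ) (s.measurableSet_biUnion fun n _ => hB n),
      indTop_coe (μ := μ) (hB a), Lp.coeFn_add (indTop μ (hB a))
        (indTop μ (s.measurableSet_biUnion fun n _ => hB n)),
      indTop_coe (μ := μ) ((insert a s).measurableSet_biUnion fun n _ => hB n)] with x h1 h2 h3 h4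
    rw [h3, h4, Pi.add_apply, h1, h2, Finset.set_biUnion_insert, Set.indicator_union_of_disjoint]
    exact Set.disjoint_iUnion₂_right.2 fun n hn => hd (by rintro rfl; exact ha hn)

/-- `F` need not be positive, so summability comes from the modulus `|F|`: finite sums of `|F 1_{B
n}|` are at most `|F| 1`. The value of the sum is then order continuity along the indicators of the
finite unions. -/
theorem hasSum_indTop (F : SigmaDual (Lp ℝ ∞ μ)) {B : ℕ → Set α} (hB : ∀ n, MeasurableSet (B n))
    (hd : Pairwise (Function.onFun Disjoint B)) :
    HasSum (fun n => F (indTop μ (hB n))) (F (indTop μ (MeasurableSet.iUnion hB))) := by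
  have hmono : ∀ {A C : Set α} (hA : MeasurableSet A) (hC : MeasurableSet C), A ⊆ C →
      indTop μ hA ≤ indTop μ hC := fun {A C} hA hC h => by
    rw [← Lp.coeFn_le]
    filter_upwards [indTop_coe (μ := μ) hA, indTop_coe (μ := μ) hC] with x h1 h2
    rw [h1, h2]
    exact Set.indicator_le_indicator_of_subset h (fun _ => zero_le_one) x
  have hs : Summable fun n => ‖F (indTop μ (hB n))‖ := by
    refine summable_of_sum_le (fun _ => norm_nonneg _)
      (c := |F| (indTop μ MeasurableSet.univ)) fun s => ?_
    calc ∑ n ∈ s, ‖F (indTop μ (hB n))‖ ≤ ∑ n ∈ s, |F| (indTop μ (hB n)) := by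
          refine Finset.sum_le_sum fun n _ => ?_
          have := SigmaDual.abs_le_abs_apply F (indTop μ (hB n))
          rwa [abs_of_nonneg (indTop_nonneg (hB n))] at this
      _ = |F| (indTop μ (s.measurableSet_biUnion fun n _ => hB n)) := by
          rw [← map_sum, sum_indTop hB hd]
      _ ≤ _ := SigmaDual.mono_of_nonneg (abs_nonneg F) (hmono _ _ (Set.subset_univ _))
  -- Absolute summability reduces the unconditional sum to the limit of the partial sums over `range
  -- n`.
  rw [hasSum_iff_tendsto_nat_of_summable_norm hs]
  simp only [← map_sum, sum_indTop hB hd]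
  refine F.tendsto_of_ae_tendsto (fun m n hmn => hmono _ _ ?_) ?_
  · exact Set.biUnion_subset_biUnion_left fun i hi =>
      Finset.mem_range.2 ((Finset.mem_range.1 hi).trans_le hmn)
  · filter_upwards [ae_all_iff.2 fun n => indTop_coe (μ := μ)
      ((Finset.range n).measurableSet_biUnion fun n _ => hB n),
      indTop_coe (μ := μ) (MeasurableSet.iUnion hB)] with x h1 h2
    simp only [h1, h2]
    -- At each such point the indicators are eventually constant: from the first index after a set
    -- containing `x`, or always if there is none.
    refine tendsto_const_nhds.congr' ?_
    by_cases hx : x ∈ ⋃ n, B n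
    · obtain ⟨N, hN⟩ := Set.mem_iUnion.1 hx
      filter_upwards [eventually_gt_atTop N] with n hn
      rw [Set.indicator_of_mem hx, Set.indicator_of_mem]
      exact Set.mem_biUnion (Finset.mem_coe.2 (Finset.mem_range.2 hn)) hN
    · refine Eventually.of_forall fun n => ?_
      beta_reduce
      rw [Set.indicator_of_notMem hx, Set.indicator_of_notMem]
      exact fun h => hx (Set.iUnion₂_subset_iUnion _ _ h)

open Classical in
/-- The signed measure `B ↦ F 1_B` of a `σ`-order continuous functional on `L^∞`. -/
noncomputable def rieszMeasure (F : SigmaDual (Lp ℝ ∞ μ)) : SignedMeasure α where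
  -- The value `0` off the measurable sets is the convention imposed by `VectorMeasure`.
  measureOf' B := if hB : MeasurableSet B then F (indTop μ hB) else 0
  empty' := by
    rw [dif_pos MeasurableSet.empty, indTop, indicatorConstLp_empty, map_zero]
  not_measurable' B hB := dif_neg hB
  m_iUnion' B hB hd := by
    simp only [hB, MeasurableSet.iUnion hB, dif_pos]
    exact hasSum_indTop F hB hd

theorem rieszMeasure_apply (F : SigmaDual (Lp ℝ ∞ μ)) {B : Set α} (hB : MeasurableSet B) :
    rieszMeasure F B = F (indTop μ hB) := dif_pos hB

/-- The elements of `L^∞` are classes modulo null sets, so the indicator of a null set is the zero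
vector. -/
theorem rieszMeasure_ac (F : SigmaDual (Lp ℝ ∞ μ)) :
    rieszMeasure F ≪ᵥ μ.toENNRealVectorMeasure :=
  VectorMeasure.AbsolutelyContinuous.mk fun B hB h => by
    rw [Measure.toENNRealVectorMeasure_apply_measurable hB] at h
    have : indTop μ hB = 0 := Lp.ext (by
      filter_upwards [indTop_coe (μ := μ) hB, Lp.coeFn_zero ℝ ∞ μ,
        measure_eq_zero_iff_ae_notMem.1 h] with x h1 h2 h3
      rw [h1, h2, Set.indicator_of_notMem h3]
      rfl)
    rw [rieszMeasure_apply F hB, this, map_zero]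

variable (μ) in
/-- `F ↦ (B ↦ F 1_B)` as a linear map. -/
noncomputable def rieszLin :
    SigmaDual (Lp ℝ ∞ μ) →ₗ[ℝ] MeasBand μ where
  toFun F := ⟨rieszMeasure F, rieszMeasure_ac F⟩
  map_add' F G := Subtype.ext <| VectorMeasure.ext fun B hB => by
    change rieszMeasure (F + G) B = (rieszMeasure F + rieszMeasure G) B
    simp only [_root_.add_apply, rieszMeasure_apply _ hB, SigmaDual.add_apply]
  map_smul' c F := Subtype.ext <| VectorMeasure.ext fun B hB => by
    change rieszMeasure (c • F) B = (c • rieszMeasure F) B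
    simp only [_root_.smul_apply, rieszMeasure_apply _ hB, SigmaDual.smul_apply, smul_eq_mul]

theorem rieszLin_apply (F : SigmaDual (Lp ℝ ∞ μ)) {B : Set α} (hB : MeasurableSet B) :
    rieszLin μ F B = F (indTop μ hB) := rieszMeasure_apply F hB

theorem integrable_bdd_mul {φ : Lp ℝ ∞ μ} {g : α → ℝ} (hg : Integrable g μ) :
    Integrable (fun x => φ x * g x) μ := hg.mul_of_top_right (Lp.memLp φ)

/-- A functional on `L^∞` with density `g` on indicators is integration against `g`. -/
theorem SigmaDual.apply_eq_integral (F : SigmaDual (Lp ℝ ∞ μ)) {g : α → ℝ} (hg : Integrable g μ)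
    (h : ∀ (B : Set α) (hB : MeasurableSet B), F (indTop μ hB) = ∫ x in B, g x ∂μ)
    (φ : Lp ℝ ∞ μ) : F φ = ∫ x, φ x * g x ∂μ := by
  -- Positive bounded functions are reached by induction on measurable functions with values in
  -- `ℝ≥0∞`. The bound `C` belongs to the motive: summands and approximants of `f` lie below `f`, so
  -- they inherit it and remain in `L^∞`. The class `φ` is quantified apart from its representative
  -- `f`.
  have key : ∀ f : α → ℝ≥0∞, Measurable f → ∀ C : NNReal, (∀ x, f x ≤ C) → ∀ φ : Lp ℝ ∞ μ,
      φ =ᵐ[μ] (fun x => (f x).toReal) → F φ = ∫ x, φ x * g x ∂μ := by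
    have mem : ∀ f : α → ℝ≥0∞, Measurable f → ∀ C : NNReal, (∀ x, f x ≤ C) →
        MemLp (fun x => (f x).toReal) ∞ μ := fun f hf C hC =>
      memLp_top_of_bound hf.ennreal_toReal.aestronglyMeasurable C (Eventually.of_forall fun x => by
        rw [Real.norm_of_nonneg ENNReal.toReal_nonneg]
        exact ENNReal.toReal_le_coe_of_le_coe (hC x))
    intro f hf
    refine Measurable.ennreal_induction (motive := fun f => ∀ C : NNReal, (∀ x, f x ≤ C) →
      ∀ φ : Lp ℝ ∞ μ, φ =ᵐ[μ] (fun x => (f x).toReal) → F φ = ∫ x, φ x * g x ∂μ) ?_ ?_ ?_ hf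
    · intro c s hs C hC φ hφ
      have e : φ = c.toReal • indTop μ hs := Lp.ext (by
        filter_upwards [hφ, indTop_coe (μ := μ) hs,
          Lp.coeFn_smul c.toReal (indTop μ hs)] with x h1 h2 h3
        rw [h1, h3, Pi.smul_apply, h2]
        by_cases hx : x ∈ s <;> simp [hx])
      have e2 : (fun x => φ x * g x) =ᵐ[μ] fun x => c.toReal * s.indicator g x := by
        filter_upwards [hφ] with x h1
        rw [h1]
        by_cases hx : x ∈ s <;> simp [hx]
      rw [integral_congr_ae e2, integral_const_mul, integral_indicator hs, ← h s hs, e, map_smul,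
        smul_eq_mul]
    · intro f₁ f₂ _ hf₁ hf₂ ih₁ ih₂ C hC φ hφ
      have b₁ : ∀ x, f₁ x ≤ C := fun x => le_self_add.trans (hC x)
      have b₂ : ∀ x, f₂ x ≤ C := fun x => le_add_self.trans (hC x)
      have m₁ := mem f₁ hf₁ C b₁
      have m₂ := mem f₂ hf₂ C b₂
      have e : φ = m₁.toLp _ + m₂.toLp _ := Lp.ext (by
        filter_upwards [hφ, m₁.coeFn_toLp, m₂.coeFn_toLp,
          Lp.coeFn_add (m₁.toLp _) (m₂.toLp _)] with x h1 h2 h3 h4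
        rw [h1, h4, Pi.add_apply, Pi.add_apply, h2, h3, ENNReal.toReal_add]
        · exact ((b₁ x).trans_lt ENNReal.coe_lt_top).ne
        · exact ((b₂ x).trans_lt ENNReal.coe_lt_top).ne)
      rw [e, map_add, ih₁ C b₁ _ m₁.coeFn_toLp, ih₂ C b₂ _ m₂.coeFn_toLp,
        ← integral_add (integrable_bdd_mul hg) (integrable_bdd_mul hg)]
      refine integral_congr_ae ?_
      filter_upwards [Lp.coeFn_add (m₁.toLp _) (m₂.toLp _)] with x h1
      rw [h1, Pi.add_apply, add_mul]
    · intro f hf hm ih C hC φ hφ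
      have b : ∀ n x, f n x ≤ C := fun n x => (le_iSup (fun n => f n x) n).trans (hC x)
      have m := fun n => mem (f n) (hf n) C (b n)
      have ht : ∀ᵐ x ∂μ, Tendsto (fun n => (m n).toLp _ x) atTop (𝓝 (φ x)) := by
        filter_upwards [hφ, ae_all_iff.2 fun n => (m n).coeFn_toLp] with x h1 h2
        simp only [h1, h2]
        exact (ENNReal.tendsto_toReal ((hC x).trans_lt ENNReal.coe_lt_top).ne).comp
          (tendsto_atTop_iSup fun i j hij => hm hij x)
      have hmo : Monotone fun n => (m n).toLp _ := fun i j hij => by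
        rw [← Lp.coeFn_le]
        filter_upwards [(m i).coeFn_toLp, (m j).coeFn_toLp] with x h1 h2
        rw [h1, h2]
        exact ENNReal.toReal_mono ((b j x).trans_lt ENNReal.coe_lt_top).ne (hm hij x)
      -- Both sides pass to the limit: the left by order continuity of `F`, the right by dominated
      -- convergence with bound `C ‖g‖`.
      have t1 := F.tendsto_of_ae_tendsto hmo ht
      simp only [fun n => ih n C (b n) _ (m n).coeFn_toLp] at t1
      refine tendsto_nhds_unique t1 (tendsto_integral_of_dominated_convergence
        (fun x => C * ‖g x‖) (fun n => (integrable_bdd_mul hg).1) (hg.norm.const_mul _) ?_ ?_)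
      · intro n
        filter_upwards [(m n).coeFn_toLp] with x h1
        rw [h1, norm_mul, Real.norm_of_nonneg ENNReal.toReal_nonneg]
        gcongr
        exact ENNReal.toReal_le_coe_of_le_coe (b n x)
      · filter_upwards [ht] with x hx using hx.mul_const _
  have hpos : ∀ φ : Lp ℝ ∞ μ, 0 ≤ φ → F φ = ∫ x, φ x * g x ∂μ := by
    intro φ hφ
    obtain ⟨C, hC⟩ : ∃ C : NNReal, ∀ᵐ x ∂μ, ‖φ x‖ ≤ C :=
      ⟨(eLpNormEssSup φ μ).toNNReal, by
        have h2 : eLpNormEssSup φ μ ≠ ∞ := by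
          rw [← eLpNorm_exponent_top]; exact (Lp.memLp φ).2.ne
        filter_upwards [ae_le_eLpNormEssSup (f := φ) (μ := μ)] with y hy
        rw [← toReal_enorm]
        exact ENNReal.toReal_mono h2 hy⟩
    -- The essential bound `C` holds only almost everywhere, whereas `key` asks for it at every
    -- point. Cutting off at `C` repairs this without changing the class.
    refine key (fun x => min (ENNReal.ofReal (φ x)) C)
      ((Lp.stronglyMeasurable φ).measurable.ennreal_ofReal.min measurable_const) C
      (fun x => min_le_right _ _) φ ?_
    filter_upwards [hC, (Lp.coeFn_nonneg φ).2 hφ] with x h1 h2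
    rw [min_eq_left, ENNReal.toReal_ofReal h2]
    rw [← ENNReal.ofReal_coe_nnreal]
    exact ENNReal.ofReal_le_ofReal ((le_abs_self _).trans h1)
  rw [← posPart_sub_negPart φ, map_sub, hpos _ (posPart_nonneg φ), hpos _ (negPart_nonneg φ),
    ← integral_sub (integrable_bdd_mul hg) (integrable_bdd_mul hg)]
  refine integral_congr_ae ?_
  filter_upwards [Lp.coeFn_sub φ⁺ φ⁻] with x h1
  rw [h1, Pi.sub_apply, sub_mul]

end Functionals

end KrnBL

namespace KrnBL

/-! ### Kernels acting on densities, and the converse of Hölder's inequality -/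

section Density

variable {α β : Type u} [MeasurableSpace α] [MeasurableSpace β] {μ : Measure α}
  [IsFiniteMeasure μ]

/-- The action is defined by the Jordan decomposition, but by `kernelAct_sub` any difference of
finite measures computes it. Here the two measures have densities `g⁺` and `g⁻`, and each
contributes an integral of `x ↦ κ x B`. -/
theorem kernelAct_withDensity (κ : Kernel α β) [IsMarkovKernel κ] {g : α → ℝ}
    (hg : Integrable g μ) {B : Set β} (hB : MeasurableSet B) :
    kernelAct κ (μ.withDensityᵥ g) B = ∫ x, (κ x).real B * g x ∂μ := by
  have hk : Measurable fun x => (κ x).real B := (κ.measurable_coe hB).ennreal_toReal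
  have hkg : ∀ {h : α → ℝ}, Integrable h μ → Integrable (fun x => h x * (κ x).real B) μ :=
    fun {h} hh => hh.mul_bdd (c := 1) hk.aestronglyMeasurable
      (Eventually.of_forall fun x => by
        rw [Real.norm_of_nonneg measureReal_nonneg]; exact measureReal_le_one)
  have key : ∀ h : α → ℝ, Integrable h μ →
      (κ ∘ₘ μ.withDensity fun x => ENNReal.ofReal (h x)).real B =
        ∫ x, max (h x) 0 * (κ x).real B ∂μ := fun h hh => by
    rw [measureReal_def, Measure.bind_apply hB κ.measurable.aemeasurable,
      ← integral_toReal (κ.measurable_coe hB).aemeasurable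
        (Eventually.of_forall fun x => measure_lt_top _ _),
      integral_withDensity_eq_integral_toReal_smul₀ hh.1.aemeasurable.ennreal_ofReal
        (Eventually.of_forall fun x => ENNReal.ofReal_lt_top)]
    rfl
  have := isFiniteMeasure_withDensity_ofReal hg.2
  have := isFiniteMeasure_withDensity_ofReal hg.neg.2
  rw [withDensityᵥ_eq_withDensity_pos_part_sub_withDensity_neg_part hg, kernelAct_sub,
    _root_.sub_apply, Measure.toSignedMeasure_apply_measurable hB,
    Measure.toSignedMeasure_apply_measurable hB, key g hg]
  have h2 := key (fun x => -g x) hg.neg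
  rw [h2, ← integral_sub (hkg hg.pos_part) (hkg hg.neg_part)]
  refine integral_congr_ae (Eventually.of_forall fun x => ?_)
  change max (g x) 0 * _ - max (-g x) 0 * _ = _
  rw [← sub_mul, max_zero_sub_max_neg_zero_eq_self, mul_comm]

/-- Converse of Hölder's inequality: a function which pairs with bounded functions as an
`L^q`-bounded functional lies in `L^p`. -/
theorem memLp_of_forall_integral_le {p q : ℝ≥0∞} [ENNReal.HolderConjugate p q] {g : α → ℝ}
    (hm : Measurable g) (hg : Integrable g μ) {C : ℝ} (hC : 0 ≤ C)
    (h : ∀ φ : α → ℝ, MemLp φ ∞ μ → ∫ x, φ x * g x ∂μ ≤ C * (eLpNorm φ q μ).toReal) :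
    MemLp g p μ := by
  -- The sign of `g`, with value `1` where `g` vanishes so that `|σ| = 1` everywhere.
  let σ : α → ℝ := fun x => if 0 ≤ g x then 1 else -1
  have hσm : Measurable σ := Measurable.ite (measurableSet_le measurable_const hm)
    measurable_const measurable_const
  have hσ : ∀ x, |σ x| = 1 := fun x => by
    by_cases hx : 0 ≤ g x <;> simp [σ, hx]
  have hσg : ∀ x, σ x * g x = |g x| := fun x => by
    by_cases hx : 0 ≤ g x
    · simp [σ, hx, abs_of_nonneg hx]
    · simp [σ, hx, abs_of_neg (not_le.1 hx)]
  rcases eq_or_ne p ∞ with rfl | hpt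
  · have hq : q = 1 := by
      have := ENNReal.HolderConjugate.inv_add_inv_eq_one ∞ q
      simpa using this
    subst hq
    refine memLp_top_of_bound hm.aestronglyMeasurable C ?_
    -- With `q = 1`, the test function `1_s σ` gives `∫_s |g| ≤ C μ(s)` for every measurable `s`,
    -- which forces `|g| ≤ C` almost everywhere.
    refine ae_le_of_forall_setIntegral_le hg.norm (integrable_const C) fun s hs _ => ?_
    have hb : ∀ x, ‖s.indicator σ x‖ ≤ 1 := fun x => by
      by_cases hx : x ∈ s <;> simp [hx, hσ]
    have h1 := h (s.indicator σ) (memLp_top_of_bound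
      (hσm.indicator hs).aestronglyMeasurable 1 (Eventually.of_forall hb))
    have e1 : (fun x => s.indicator σ x * g x) = s.indicator fun x => ‖g x‖ := by
      ext x
      by_cases hx : x ∈ s <;> simp [hx, hσg]
    have e2 : (eLpNorm (s.indicator σ) 1 μ).toReal = μ.real s := by
      rw [eLpNorm_one_eq_lintegral_enorm, measureReal_def]
      congr 1
      have : ∀ x, ‖s.indicator σ x‖ₑ = s.indicator 1 x := fun x => by
        by_cases hx : x ∈ s <;> simp [hx, ← ofReal_norm, hσ]
      simp only [this, lintegral_indicator_one hs]
    rw [e1, e2, integral_indicator hs] at h1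
    rw [setIntegral_const, smul_eq_mul, mul_comm]
    exact h1
  rcases eq_or_ne p 1 with rfl | hp1
  · exact memLp_one_iff_integrable.2 hg
  have hpg : 1 < p := lt_of_le_of_ne (ENNReal.HolderConjugate.one_le p q) hp1.symm
  have hp0 : p ≠ 0 := (zero_lt_one.trans hpg).ne'
  have hpr : 1 < p.toReal := by
    rw [← ENNReal.toReal_one]
    exact (ENNReal.toReal_lt_toReal ENNReal.one_ne_top hpt).2 hpg
  have hpq : p.toReal.HolderConjugate q.toReal := ENNReal.HolderConjugate.toReal hpr
  have hqt : q ≠ ∞ := by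
    rintro rfl
    simpa using hpq.symm.pos
  have hq0 : q ≠ 0 := by
    rintro rfl
    simpa using hpq.symm.pos
  set r := p.toReal with hr
  set s := q.toReal with hs
  -- `g` is replaced by zero where `|g| > n`. The truncations are bounded, so their powers are
  -- admissible test functions and their `L^p` norms are finite in advance.
  let k : ℕ → α → ℝ := fun n x => if |g x| ≤ n then g x else 0
  have hkm : ∀ n, Measurable (k n) := fun n =>
    Measurable.ite (measurableSet_le hm.abs measurable_const) hm measurable_const
  have hkb : ∀ n x, |k n x| ≤ n := fun n x => by
    by_cases hx : |g x| ≤ n <;> simp [k, hx]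
  have hbound : ∀ n, eLpNorm (k n) p μ ≤ ENNReal.ofReal C := by
    intro n
    -- The equality case of Hölder: `φ g = |k n|^r`, and `|φ|^s = |k n|^r` since `(r - 1) s = r`.
    -- Where `k n` vanishes both are zero because `r > 1`.
    let φ : α → ℝ := fun x => σ x * |k n x| ^ (r - 1)
    have hφm : Measurable φ := hσm.mul ((hkm n).abs.pow_const _)
    have hφa : ∀ x, ‖φ x‖ = |k n x| ^ (r - 1) := fun x => by
      rw [norm_mul, Real.norm_eq_abs, hσ, one_mul, Real.norm_of_nonneg (by positivity)]
    have hφ : MemLp φ ∞ μ := memLp_top_of_bound hφm.aestronglyMeasurable ((n : ℝ) ^ (r - 1))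
      (Eventually.of_forall fun x => by
        rw [hφa]
        exact Real.rpow_le_rpow (abs_nonneg _) (hkb n x) (by linarith))
    have hk : MemLp (k n) ∞ μ := memLp_top_of_bound (hkm n).aestronglyMeasurable n
      (Eventually.of_forall (hkb n))
    have h1 := h φ hφ
    set I := ∫ x, |k n x| ^ r ∂μ with hI
    have hI0 : 0 ≤ I := integral_nonneg fun x => by positivity
    have e1 : ∀ x, φ x * g x = |k n x| ^ r := fun x => by
      by_cases hx : |g x| ≤ n
      · have : k n x = g x := if_pos hx
        change σ x * |k n x| ^ (r - 1) * g x = _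
        rw [this, mul_right_comm, hσg]
        nth_rewrite 1 [← Real.rpow_one |g x|]
        rw [← Real.rpow_add_of_nonneg (abs_nonneg _) zero_le_one (by linarith)]
        congr 1
        ring
      · have : k n x = 0 := if_neg hx
        change σ x * |k n x| ^ (r - 1) * g x = _
        rw [this, abs_zero, Real.zero_rpow (by linarith), Real.zero_rpow (by linarith)]
        ring
    have e2 : ∀ x, ‖φ x‖ ^ s = |k n x| ^ r := fun x => by
      rw [hφa, ← Real.rpow_mul (abs_nonneg _), hpq.sub_one_mul_conj]
    have e3 : (eLpNorm φ q μ).toReal = I ^ s⁻¹ := by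
      rw [MemLp.eLpNorm_eq_integral_rpow_norm hq0 hqt (hφ.mono_exponent le_top), ← hs]
      simp only [e2]
      exact ENNReal.toReal_ofReal (by positivity)
    simp only [e1] at h1
    rw [e3, ← hI] at h1
    rw [MemLp.eLpNorm_eq_integral_rpow_norm hp0 hpt (hk.mono_exponent le_top)]
    refine ENNReal.ofReal_le_ofReal ?_
    change I ^ r⁻¹ ≤ C
    -- The hypothesis now reads `I ≤ C I^(1/s)`. Dividing by `I^(1/s)`, which needs `I > 0`, leaves
    -- `I^(1/r) ≤ C`.
    rcases hI0.eq_or_lt with h0 | h0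
    · rw [← h0, Real.zero_rpow (inv_ne_zero (by linarith))]
      exact hC
    · have : I ^ r⁻¹ * I ^ s⁻¹ = I := by
        rw [← Real.rpow_add h0, hpq.inv_add_inv_eq_one, Real.rpow_one]
      refine le_of_mul_le_mul_right ?_ (Real.rpow_pos_of_pos h0 s⁻¹)
      rwa [this]
  refine ⟨hm.aestronglyMeasurable, lt_of_le_of_lt ?_ (ENNReal.ofReal_lt_top (r := C))⟩
  -- Fatou's lemma for `L^p` norms: `k n → g` pointwise, and all the norms are at most `C`.
  refine (Lp.eLpNorm_lim_le_liminf_eLpNorm (f := k) (fun n => (hkm n).aestronglyMeasurable) g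
    (Eventually.of_forall fun x => ?_)).trans
      (liminf_le_of_le (by isBoundedDefault) fun b hb => ?_)
  · refine tendsto_const_nhds.congr' ?_
    obtain ⟨N, hN⟩ := exists_nat_ge |g x|
    filter_upwards [eventually_ge_atTop N] with n hn
    exact (if_pos (hN.trans (Nat.cast_le.2 hn))).symm
  · obtain ⟨n, hn⟩ := hb.exists
    exact hn.trans (hbound n)

end Density

/-! ### The Radon–Nikodym and Riesz transformations and their naturality -/

section Transformations

variable {X Y : Krn.{u}}

/-- The indefinite integral intertwines the action of `f` on measures with that of `f†` on
densities. -/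
theorem bandMapLin_l1Equiv (f : Krn.Arrow X Y) (φ : Lp ℝ 1 X.measure) :
    bandMapLin f (MeasBand.l1Equiv X.measure φ) = MeasBand.l1Equiv Y.measure (lpMapFun 1 f.dagger φ) := by
  refine MeasBand.ext fun B hB => ?_
  have hφ := L1.integrable_coeFn φ
  -- The joint law of `(x, y)` disintegrates along either factor. Both sides of the claim are the
  -- integral of `φ(x) 1_B(y)` against it.
  have hswap : Y.measure ⊗ₘ f.dagger.kernel = (X.measure ⊗ₘ f.kernel).map Prod.swap := by
    have h := compProd_posterior_eq_map_swap (κ := f.kernel) (μ := X.measure)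
    rwa [f.comp_measure] at h
  have e1 : bandMapLin f (MeasBand.l1Equiv X.measure φ) B =
      ∫ x, (f.kernel x).real B * φ x ∂X.measure := kernelAct_withDensity f.kernel hφ hB
  have e2 : MeasBand.l1Equiv Y.measure (lpMapFun 1 f.dagger φ) B =
      ∫ y in B, lpMapFun 1 f.dagger φ y ∂Y.measure := MeasBand.ofL1_apply _ hB
  have hint : Integrable (fun z : X × Y => (Set.univ ×ˢ B).indicator (fun z => φ z.1) z)
      (X.measure ⊗ₘ f.kernel) := by
    refine Integrable.indicator ?_ (MeasurableSet.univ.prod hB)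
    -- Since `f` is Markov, the first marginal of the joint law is the measure of `X`, for which `φ`
    -- is integrable.
    have h : Integrable φ ((X.measure ⊗ₘ f.kernel).map Prod.fst) := by
      have h2 : (X.measure ⊗ₘ f.kernel).fst = X.measure := Measure.fst_compProd _ _
      rw [Measure.fst] at h2
      rwa [h2]
    exact h.comp_measurable measurable_fst
  have hint2 : Integrable (fun z : Y × X => B.indicator (fun _ => φ z.2) z.1)
      (Y.measure ⊗ₘ f.dagger.kernel) := by
    rw [hswap, integrable_map_measure _ measurable_swap.aemeasurable]
    · refine hint.congr (Eventually.of_forall fun z => ?_)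
      by_cases hz : z.2 ∈ B <;> simp [hz]
    · have : (fun z : Y × X => B.indicator (fun _ => φ z.2) z.1) =
          (B ×ˢ Set.univ).indicator fun z => φ z.2 := by
        ext z
        by_cases hz : z.1 ∈ B <;> simp [hz]
      rw [this]
      exact (((Lp.stronglyMeasurable φ).comp_measurable measurable_snd).indicator
        (hB.prod MeasurableSet.univ)).aestronglyMeasurable
  have h1 := Measure.integral_compProd hint
  have h2 := Measure.integral_compProd hint2
  rw [e1, e2, ← integral_indicator hB]
  calc ∫ x, (f.kernel x).real B * φ x ∂X.measure
      = ∫ x, ∫ y, (Set.univ ×ˢ B).indicator (fun z : X × Y => φ z.1) (x, y) ∂f.kernel x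
          ∂X.measure := by
        refine integral_congr_ae (Eventually.of_forall fun x => ?_)
        have : ∀ y, (Set.univ ×ˢ B).indicator (fun z : X × Y => φ z.1) (x, y) =
            B.indicator (fun _ => φ x) y := fun y => by
          by_cases hy : y ∈ B <;> simp [hy]
        simp only [this]
        rw [integral_indicator hB, setIntegral_const, smul_eq_mul]
    _ = ∫ z, B.indicator (fun _ => φ z.2) z.1 ∂(Y.measure ⊗ₘ f.dagger.kernel) := by
        rw [← h1, hswap, integral_map measurable_swap.aemeasurable (by
          rw [← hswap]; exact hint2.1)]
        refine integral_congr_ae (Eventually.of_forall fun z => ?_)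
        by_cases hz : z.2 ∈ B <;> simp [hz]
    _ = ∫ y, B.indicator (fun y => lpMapFun 1 f.dagger φ y) y ∂Y.measure := by
        rw [h2]
        refine integral_congr_ae ?_
        filter_upwards [lpMapFun_coe 1 f.dagger φ] with y hy
        by_cases hyB : y ∈ B <;> simp [hyB, hy]

/-- The inverse comes from bijectivity alone. Integrating the Radon–Nikodym derivative back to `ρ`
identifies the two. -/
theorem l1Equiv_symm_eq (ρ : MeasBand X.measure) :
    (MeasBand.l1Equiv X.measure).symm ρ =
      (SignedMeasure.integrable_rnDeriv ρ.val X.measure).toL1 _ := by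
  rw [LinearEquiv.symm_apply_eq]
  refine Subtype.ext ?_
  change ρ.val = X.measure.withDensityᵥ _
  rw [WithDensityᵥEq.congr_ae (Integrable.coeFn_toL1 _)]
  exact (SignedMeasure.withDensityᵥ_rnDeriv_eq ρ.val X.measure ρ.ac).symm

theorem l1Equiv_symm_nonneg {ρ : MeasBand X.measure} (h : 0 ≤ ρ) :
    0 ≤ (MeasBand.l1Equiv X.measure).symm ρ := by
  rw [← map_zero (MeasBand.l1Equiv X.measure).symm]
  exact MeasBand.l1Equiv_symm_le_iff.2 h

theorem l1Equiv_symm_isLUB {v : ℕ → MeasBand X.measure} {ρ : MeasBand X.measure}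
    (hρ : IsLUB (Set.range v) ρ) :
    IsLUB (Set.range fun n => (MeasBand.l1Equiv X.measure).symm (v n))
      ((MeasBand.l1Equiv X.measure).symm ρ) := by
  constructor
  · rintro _ ⟨n, rfl⟩
    exact MeasBand.l1Equiv_symm_le_iff.2 (hρ.1 ⟨n, rfl⟩)
  · intro ψ hψ
    obtain ⟨τ, rfl⟩ := (MeasBand.l1Equiv X.measure).symm.surjective ψ
    refine MeasBand.l1Equiv_symm_le_iff.2 (hρ.2 ?_)
    rintro _ ⟨n, rfl⟩
    exact MeasBand.l1Equiv_symm_le_iff.1 (hψ ⟨n, rfl⟩)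

theorem l1Equiv_symm_bandMapLin (f : Krn.Arrow X Y) (ρ : MeasBand X.measure) :
    (MeasBand.l1Equiv Y.measure).symm (bandMapLin f ρ) =
      lpMapFun 1 f.dagger ((MeasBand.l1Equiv X.measure).symm ρ) := by
  rw [LinearEquiv.symm_apply_eq, ← bandMapLin_l1Equiv, LinearEquiv.apply_symm_apply]

/-- The Radon–Nikodym transformation. -/
noncomputable def radonNikodym : BandFun.{u} ⟶ LpCov.{u} 1 where
  app X :=
    { toLinearMap := (MeasBand.l1Equiv X.measure).symm.toLinearMap
      pos := fun _ h => l1Equiv_symm_nonneg h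
      map_isLUB := fun _ _ _ hρ => l1Equiv_symm_isLUB hρ }
  naturality := by
    rintro X Y ⟨f⟩
    exact BanLat.hom_ext fun ρ => l1Equiv_symm_bandMapLin f ρ

/-- The density of a functional on `L^∞`. -/
noncomputable def density (F : SigmaDual (Lp ℝ ∞ X.measure)) : Lp ℝ 1 X.measure :=
  (MeasBand.l1Equiv X.measure).symm (rieszLin X.measure F)

theorem l1Equiv_density (F : SigmaDual (Lp ℝ ∞ X.measure)) :
    MeasBand.l1Equiv X.measure (density F) = rieszLin X.measure F :=
  LinearEquiv.apply_symm_apply _ _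

theorem apply_eq_integral_density (F : SigmaDual (Lp ℝ ∞ X.measure))
    (φ : Lp ℝ ∞ X.measure) : F φ = ∫ x, φ x * density F x ∂X.measure :=
  F.apply_eq_integral (L1.integrable_coeFn _) (fun B hB => by
    rw [← rieszLin_apply F hB, ← l1Equiv_density]
    exact MeasBand.ofL1_apply _ hB) φ

theorem rieszLin_nonneg {F : SigmaDual (Lp ℝ ∞ X.measure)} (h : 0 ≤ F) :
    0 ≤ rieszLin X.measure F := fun B hB => by
  rw [rieszLin_apply F hB]
  exact h _ (indTop_nonneg hB)

/-- Suprema of increasing sequences of functionals are pointwise limits on the positive cone, and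
the indicators belong to that cone. -/
theorem rieszLin_isLUB {F : ℕ → SigmaDual (Lp ℝ ∞ X.measure)}
    {G : SigmaDual (Lp ℝ ∞ X.measure)} (hF : Monotone F) (hG : IsLUB (Set.range F) G) :
    IsLUB (Set.range fun n => rieszLin X.measure (F n)) (rieszLin X.measure G) := by
  constructor
  · rintro _ ⟨n, rfl⟩ B hB
    beta_reduce
    rw [rieszLin_apply _ hB, rieszLin_apply _ hB]
    exact hG.1 ⟨n, rfl⟩ _ (indTop_nonneg hB)
  · intro τ hτ B hB
    rw [rieszLin_apply _ hB]
    refine le_of_tendsto' (SigmaDual.tendsto_of_isLUB hF hG (indTop_nonneg hB)) fun n => ?_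
    rw [← rieszLin_apply _ hB]
    exact hτ ⟨n, rfl⟩ B hB

/-- Naturality of the Riesz transformation. The function `x ↦ f(x)(B)` is in general not an
indicator, so the integral representation of `F` on the whole of `L^∞` is needed. -/
theorem rieszLin_comp_lpMap (f : Krn.Arrow X Y) (F : SigmaDual (Lp ℝ ∞ X.measure))
    (G : SigmaDual (Lp ℝ ∞ Y.measure)) (h : ∀ φ, G φ = F (lpMapFun ∞ f φ)) :
    rieszLin Y.measure G = bandMapLin f (rieszLin X.measure F) := by
  refine MeasBand.ext fun B hB => ?_
  rw [rieszLin_apply _ hB, ← l1Equiv_density, h]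
  change _ = kernelAct f.kernel (X.measure.withDensityᵥ (density F)) B
  rw [kernelAct_withDensity f.kernel (L1.integrable_coeFn _) hB, apply_eq_integral_density]
  refine integral_congr_ae ?_
  filter_upwards [lpMapFun_coe ∞ f (indTop Y.measure hB),
    f.ae_ae (indTop_coe (μ := Y.measure) hB)] with x h1 h2
  rw [h1, integral_congr_ae h2, integral_indicator hB, setIntegral_const, smul_eq_mul, mul_one]

/-- The Riesz representation transformation. -/
noncomputable def rieszRep : LpDual.{u} ∞ ⟶ BandFun.{u} where
  app X :=
    { toLinearMap := rieszLin X.measure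
      pos := fun _ h => rieszLin_nonneg h
      map_isLUB := fun _ _ hF hG => rieszLin_isLUB hF hG }
  naturality := by
    rintro X Y ⟨f⟩
    exact BanLat.hom_ext fun F => rieszLin_comp_lpMap f F _ fun φ => rfl

end Transformations

end KrnBL

namespace KrnBL

/-! ### Conjugate exponents: restriction to `L^∞` and lifting to `L^p` -/

section Restriction

variable {X : Krn.{u}} {p q : ℝ≥0∞} [Fact (1 ≤ p)] [Fact (1 ≤ q)]

/-- The restriction of a functional on `L^q` to `L^∞`. -/
noncomputable def restrictTop (F : SigmaDual (Lp ℝ q X.measure)) :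
    SigmaDual (Lp ℝ ∞ X.measure) :=
  ((lpDualRestrict (le_top : q ≤ ∞)).app X).toLinearMap F

theorem restrictTop_apply (F : SigmaDual (Lp ℝ q X.measure)) (φ : Lp ℝ ∞ X.measure) :
    restrictTop F φ = F (lpInclLin le_top X φ) := rfl

/-- Each `φ ≥ 0` in `L^q` is the increasing limit of the bounded functions `min φ n`, so order
continuity recovers `F φ` from values on `L^∞`. Norm density plays no role, and every `q` is treated
alike. -/
theorem restrictTop_injective :
    Function.Injective (restrictTop : SigmaDual (Lp ℝ q X.measure) → _) := by
  intro F G h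
  refine SigmaDual.ext_nonneg fun φ hφ => ?_
  have hφ0 := (Lp.coeFn_nonneg φ).2 hφ
  have hm : ∀ n : ℕ, MemLp (fun x => min (φ x) n) ∞ X.measure := fun n =>
    memLp_top_of_bound ((Lp.aestronglyMeasurable φ).inf aestronglyMeasurable_const) n (by
      filter_upwards [hφ0] with x hx
      rw [Real.norm_of_nonneg (le_min hx n.cast_nonneg)]
      exact min_le_right _ _)
  let v : ℕ → Lp ℝ q X.measure := fun n => lpInclLin le_top X ((hm n).toLp _)
  have hv : ∀ᵐ x ∂X.measure, ∀ n, v n x = min (φ x) n := ae_all_iff.2 fun n =>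
    (lpInclLin_coe le_top X _).trans (hm n).coeFn_toLp
  have hmono : Monotone v := fun m n hmn => by
    rw [← Lp.coeFn_le]
    filter_upwards [hv] with x hx
    rw [hx, hx]
    exact min_le_min_left _ (Nat.cast_le.2 hmn)
  have ht : ∀ᵐ x ∂X.measure, Tendsto (fun n => v n x) atTop (𝓝 (φ x)) := by
    filter_upwards [hv] with x hx
    obtain ⟨N, hN⟩ := exists_nat_ge (φ x)
    refine tendsto_const_nhds.congr' ?_
    filter_upwards [eventually_ge_atTop N] with n hn
    rw [hx, min_eq_left (hN.trans (Nat.cast_le.2 hn))]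
  refine tendsto_nhds_unique (F.tendsto_of_ae_tendsto hmono ht) ?_
  refine (G.tendsto_of_ae_tendsto hmono ht).congr fun n => ?_
  exact (congrArg (fun H : SigmaDual (Lp ℝ ∞ X.measure) => H ((hm n).toLp _)) h).symm

theorem lpInclLin_injective (h : p ≤ q) : Function.Injective (lpInclLin h X) := fun φ ψ e =>
  Lp.ext (by
    have h1 := lpInclLin_coe h X φ
    rw [e] at h1
    exact h1.symm.trans (lpInclLin_coe h X ψ))

theorem lpInclLin_le_iff (h : p ≤ q) {φ ψ : Lp ℝ q X.measure} :
    lpInclLin h X φ ≤ lpInclLin h X ψ ↔ φ ≤ ψ := by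
  rw [← Lp.coeFn_le, ← Lp.coeFn_le]
  constructor <;> intro hle <;>
    filter_upwards [hle, lpInclLin_coe h X φ, lpInclLin_coe h X ψ] with x h1 h2 h3
  · rwa [h2, h3] at h1
  · rwa [h2, h3]

/-- The inclusion `L^q ⊆ L^p` reflects suprema of sequences. -/
theorem isLUB_of_lpInclLin (h : p ≤ q) {v : ℕ → Lp ℝ q X.measure} {φ : Lp ℝ q X.measure}
    (hφ : IsLUB (Set.range fun n => lpInclLin h X (v n)) (lpInclLin h X φ)) :
    IsLUB (Set.range v) φ := by
  constructor
  · rintro _ ⟨n, rfl⟩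
    exact (lpInclLin_le_iff h).1 (hφ.1 ⟨n, rfl⟩)
  · intro ψ hψ
    refine (lpInclLin_le_iff h).1 (hφ.2 ?_)
    rintro _ ⟨n, rfl⟩
    exact (lpInclLin_le_iff h).2 (hψ ⟨n, rfl⟩)

theorem lpDualRestrict_injective (X : Krn.{u}) : Function.Injective
    ((lpDualRestrict (le_top : q ≤ ∞)).app X : (LpDual q).obj X → (LpDual ∞).obj X) :=
  restrictTop_injective

theorem lpCovIncl_injective (h : p ≤ q) (X : Krn.{u}) : Function.Injective
    ((lpCovIncl h).app X : (LpCov q).obj X → (LpCov p).obj X) :=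
  lpInclLin_injective h

/-- A morphism into `L^p` with values in `L^q` factors through the inclusion. -/
theorem exists_lift (h : p ≤ q) {V : BanLat.{u}} (T : V ⟶ lpObj p X)
    (hT : ∀ v, ∃ φ : Lp ℝ q X.measure, lpInclLin h X φ = T v) :
    ∃ S : V ⟶ lpObj q X, S ≫ lpInclApp h X = T := by
  -- Injectivity of the inclusion makes the chosen preimages unique, hence linear in `v`.
  choose s hs using hT
  have hadd : ∀ v w, s (v + w) = s v + s w := fun v w => lpInclLin_injective h (by
    rw [map_add, hs, hs, hs]; exact map_add T.toLinearMap v w)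
  have hsmul : ∀ (c : ℝ) v, s (c • v) = c • s v := fun c v => lpInclLin_injective h (by
    rw [map_smul, hs, hs]; exact map_smul T.toLinearMap c v)
  refine ⟨⟨⟨⟨s, hadd⟩, hsmul⟩, fun v hv => ?_, fun v x hv hx => ?_⟩,
    BanLat.hom_ext fun v => hs v⟩
  · change 0 ≤ s v
    rw [← lpInclLin_le_iff h, hs, map_zero]
    exact T.pos v hv
  · refine isLUB_of_lpInclLin h (v := fun n => s (v n)) (φ := s x) ?_
    simp only [hs]
    exact T.map_isLUB v x hv hx

/-- A natural transformation into `L^p` whose values lie in `L^q` factors uniquely through the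
inclusion. -/
theorem existsUnique_lift (h : p ≤ q) {Φ : Krn.{u} ⥤ BanLat.{u}} (T : Φ ⟶ LpCov.{u} p)
    (hT : ∀ (X : Krn.{u}) (v : Φ.obj X), ∃ φ : Lp ℝ q X.measure, lpInclLin h X φ = T.app X v) :
    ∃! η : Φ ⟶ LpCov.{u} q, η ≫ lpCovIncl h = T := by
  -- The components of the inclusion are left-cancellable, so naturality and uniqueness can be
  -- checked after composing into `L^p`.
  have hmono : ∀ {V : BanLat.{u}} {X : Krn.{u}} {S S' : V ⟶ (LpCov q).obj X},
      S ≫ (lpCovIncl h).app X = S' ≫ (lpCovIncl h).app X → S = S' := fun {V X S S'} e =>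
    BanLat.hom_ext fun v => lpCovIncl_injective h X
      (congrArg (fun R : V ⟶ (LpCov p).obj X => R v) e)
  obtain ⟨s, hs⟩ : ∃ s : ∀ X, Φ.obj X ⟶ (LpCov q).obj X, ∀ X, s X ≫ (lpCovIncl h).app X = T.app X :=
    ⟨fun X => (exists_lift (X := X) h (T.app X) (hT X)).choose,
      fun X => (exists_lift (X := X) h (T.app X) (hT X)).choose_spec⟩
  refine ⟨⟨s, fun X Y f => hmono ?_⟩, NatTrans.ext (funext hs), fun η hη => ?_⟩
  · rw [Category.assoc, Category.assoc, hs, T.naturality, (lpCovIncl h).naturality, ← Category.assoc,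
      hs]
  · refine NatTrans.ext (funext fun X => hmono ?_)
    rw [hs, ← hη]
    rfl

/-- For bounded `φ` the integral against the density is `F φ`, at most `‖F‖ ‖φ‖_q`. The converse of
Hölder's inequality applies with constant `‖F‖`. -/
theorem density_memLp [ENNReal.HolderConjugate p q] (F : SigmaDual (Lp ℝ q X.measure)) :
    MemLp (density (restrictTop F)) p X.measure := by
  refine memLp_of_forall_integral_le (q := q) (Lp.stronglyMeasurable _).measurable
    (L1.integrable_coeFn _) (norm_nonneg F) fun φ hφ => ?_
  have e : ∫ x, φ x * density (restrictTop F) x ∂X.measure = restrictTop F (hφ.toLp φ) := by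
    rw [apply_eq_integral_density]
    refine integral_congr_ae ?_
    filter_upwards [hφ.coeFn_toLp] with x hx
    rw [hx]
  rw [e, restrictTop_apply]
  refine (le_abs_self _).trans ((F.abs_apply_le _).trans_eq ?_)
  rw [Lp.norm_def, eLpNorm_congr_ae ((lpInclLin_coe le_top X _).trans hφ.coeFn_toLp)]

theorem exists_lpInclLin_eq_density [ENNReal.HolderConjugate p q]
    (F : SigmaDual (Lp ℝ q X.measure)) : ∃ φ : Lp ℝ p X.measure,
      lpInclLin (Fact.out : 1 ≤ p) X φ = density (restrictTop F) :=
  ⟨(density_memLp F).toLp _, Lp.ext ((lpInclLin_coe _ X _).trans (density_memLp F).coeFn_toLp)⟩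

end Restriction

end KrnBL

/-- The first two clauses determine `rr` and `rn`, since a signed measure is fixed by its values on
measurable sets. The existential therefore speaks of exactly these two families, and naturality is
contained in their types. -/
theorem mainTheorem6 (p q : ℝ≥0∞) [Fact (1 ≤ p)] [Fact (1 ≤ q)]
    (hpq : ENNReal.HolderConjugate p q) :
    ∃ (rr : LpDual.{u} ∞ ⟶ BandFun.{u}) (rn : BandFun.{u} ⟶ LpCov.{u} 1),
      -- `rr` is the Riesz representation transformation
      (∀ (X : Krn.{u}) (F : SigmaDual (Lp ℝ ∞ X.measure)) (B : Set X) (hB : MeasurableSet B),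
        MeasBand.val (μ := X.measure) (rr.app X F) B =
          F (indicatorConstLp ∞ hB (measure_ne_top X.measure B) (1 : ℝ))) ∧
      -- `rn` is the Radon-Nikodym transformation
      (∀ (X : Krn.{u}) (ρ : MeasBand X.measure),
        rn.app X ρ = (SignedMeasure.integrable_rnDeriv ρ.val X.measure).toL1 _) ∧
      -- functionals on `L^q` are determined by their restrictions to `L^∞`, and `L^p` sits in `L^1`
      (∀ X : Krn.{u}, Function.Injective
        ((lpDualRestrict (le_top : q ≤ ∞)).app X : (LpDual q).obj X → (LpDual ∞).obj X)) ∧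
      (∀ X : Krn.{u}, Function.Injective
        ((lpCovIncl (Fact.out : 1 ≤ p)).app X : (LpCov p).obj X → (LpCov 1).obj X)) ∧
      -- `rn ∘ rr` restricts to a natural transformation between the subfunctors
      ∃! η : LpDual.{u} q ⟶ LpCov.{u} p,
        η ≫ lpCovIncl (Fact.out : 1 ≤ p) = lpDualRestrict (le_top : q ≤ ∞) ≫ rr ≫ rn :=
  ⟨rieszRep, radonNikodym, fun _ F _ hB => rieszLin_apply F hB, fun _ ρ => l1Equiv_symm_eq ρ,
    lpDualRestrict_injective, lpCovIncl_injective _,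
    existsUnique_lift _ _ fun _ F => exists_lpInclLin_eq_density F⟩
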